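/- Let $K$ be an algebraically closed field and $R = K[x,y,z,t]$ with its standard grading. Let $h, F, G \in K[z,t]$, $A \in K[x,z,t]$, $B \in K[y,z,t]$ be homogeneous polynomials (each possibly zero unless excluded below) with $F, G \notin K$, and suppose $AB \neq 0$ in case $h = 0$. Let $d_F = \deg F$, $d_G = \deg G$, and let $d_h$ be an integer such that $h$ is homogeneous of degree $d_h$, $A$ is homogeneous of degree $d_h + d_F - 1$ and $B$ is homogeneous of degree $d_h + d_G - 1$ (the zero polynomial being homogeneous of every integer degree). Thus $d_h = \deg h$ if $h \neq 0$, while $d_h = \deg A - d_F + 1 = \deg B - d_G + 1$, possibly negative, if $h = 0$; the degree conditions say precisely that the four generators below are homogeneous. Consider the homogeneous ideal $$J = \left(xy,\ x^2A + xhF,\ y^2B + yhG,\ xAG + yBF + hFG\right) \subset R .$$ Then $J$ defines a one-dimensional closed subscheme $C = \operatorname{Proj}(R/J) \subset \mathbb{P}^3_K$ of degree $2d_h + d_F + d_G$ (that is, its Hilbert polynomial has degree $1$ and leading coefficient $2d_h + d_F + d_G$). Moreover, $J$ has the minimal graded free resolution $$0 \to F_3 \xrightarrow{\varphi_3} F_2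 \xrightarrow{\varphi_2} F_1 \xrightarrow{\varphi_1} J \to 0,$$ where \begin{align*} F_1 &= R(-2) \oplus R(-d_F-d_h-1) \oplus R(-d_G-d_h-1) \oplus R(-d_F-d_G-d_h),\\ F_2 &= R(-d_F-d_h-2) \oplus R(-d_G-d_h-2) \oplus R(-d_F-d_G-d_h-1)^2,\\ F_3 &= R(-d_F-d_G-d_h-2), \end{align*} and the maps are given by the matrices $$\varphi_1 = \begin{bmatrix} xy & x^2A+xhF & y^2B+yhG & xAG+yBF+hFG \end{bmatrix},$$ $$\varphi_2 = \begin{bmatrix} xA+hF & yB+hG & AG & BF \\ -y & 0 & 0 & G \\ 0 & -x & F & 0 \\ 0 & 0 & -y & -x \end{bmatrix}, \qquad \varphi_3 = \begin{bmatrix} G \\ -F \\ -x \\ y \end{bmatrix}.$$ Finally, $C$ is a curve, i.e. it is nonempty, all its irreducible components have dimension one, and all its local rings are Cohen-Macaulay, if and only if $x, y, F, G$ is a regular sequence in $R$. -/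

import Mathlib

open MvPolynomial AlgebraicGeometry

noncomputable section

/-! ### The standard graded polynomial ring and its homogeneous quotients -/

/-- The homogeneous coordinate ring `K[x, y, z, t]` of `ℙ³`; the variables `x, y, z, t` are
`X 0, X 1, X 2, X 3`. -/
abbrev CoordRing (K : Type*) [Field K] : Type _ := MvPolynomial (Fin 4) K

/-- The standard grading of `K[x, y, z, t]`. -/
abbrev stdGrading (K : Type*) [Field K] : ℕ → Submodule K (CoordRing K) :=
  homogeneousSubmodule (Fin 4) K

instance stdGrading.gradedAlgebra (K : Type*) [Field K] : GradedAlgebra (stdGrading K) :=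
  MvPolynomial.gradedAlgebra

/-- The grading of the quotient `K[x, y, z, t] ⧸ J` by a homogeneous ideal `J`: the piece of
degree `n` consists of the residue classes of the forms of degree `n`. -/
def quotGrading {K : Type*} [Field K] (J : HomogeneousIdeal (stdGrading K)) (n : ℕ) :
    Submodule K (CoordRing K ⧸ J.toIdeal) :=
  (stdGrading K n).map (Ideal.Quotient.mkₐ K J.toIdeal).toLinearMap

theorem mem_quotGrading {K : Type*} [Field K] {J : HomogeneousIdeal (stdGrading K)} {n : ℕ}
    {q : CoordRing K ⧸ J.toIdeal} :
    q ∈ quotGrading J n ↔ ∃ p ∈ stdGrading K n, Ideal.Quotient.mk J.toIdeal p = q :=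
  Iff.rfl

instance quotGrading.gradedMonoid {K : Type*} [Field K] (J : HomogeneousIdeal (stdGrading K)) :
    SetLike.GradedMonoid (quotGrading J) where
  one_mem := mem_quotGrading.2 ⟨1, SetLike.GradedOne.one_mem, map_one _⟩
  mul_mem := by
    rintro i j _ _ ⟨p, hp, rfl⟩ ⟨q, hq, rfl⟩
    exact mem_quotGrading.2 ⟨p * q, SetLike.GradedMul.mul_mem hp hq, map_mul _ _ _⟩

theorem quotGrading.isInternal {K : Type*} [Field K] (J : HomogeneousIdeal (stdGrading K)) :
    DirectSum.IsInternal (quotGrading J) := by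
  classical
  constructor
  · rw [injective_iff_map_eq_zero]
    intro s hs
    have hlift : ∀ i, ∃ p : CoordRing K, p ∈ stdGrading K i ∧
        Ideal.Quotient.mk J.toIdeal p = (s i : CoordRing K ⧸ J.toIdeal) := fun i => by
      obtain ⟨p, hp, hq⟩ := mem_quotGrading.1 (s i).2
      exact ⟨p, hp, hq⟩
    choose p hp hq using hlift
    have hsum : ∑ i ∈ s.support, p i ∈ J.toIdeal := by
      rw [← Ideal.Quotient.eq_zero_iff_mem, map_sum]
      rw [DirectSum.coeAddMonoidHom_eq_dfinsuppSum, DFinsupp.sum] at hs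
      rw [← hs]
      exact Finset.sum_congr rfl fun i _ => hq i
    have key : ∀ j ∈ s.support, p j ∈ J.toIdeal := by
      intro j hj
      have h1 := (homogeneousComponent_mem_of_mem J.isHomogeneous hsum j)
      rw [map_sum, Finset.sum_eq_single j] at h1
      · rwa [homogeneousComponent_of_mem (hp j), if_pos rfl] at h1
      · intro i _ hij
        rw [homogeneousComponent_of_mem (hp i), if_neg hij.symm]
      · exact fun h => absurd hj h
    ext j
    by_cases hj : j ∈ s.support
    · rw [← hq j, Ideal.Quotient.eq_zero_iff_mem.2 (key j hj)]
      rfl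
    · rw [DFinsupp.notMem_support_iff.1 hj]
      rfl
  · intro q
    obtain ⟨p, rfl⟩ := Ideal.Quotient.mk_surjective q
    refine ⟨∑ i ∈ Finset.range (p.totalDegree + 1), DirectSum.of (fun i => quotGrading J i) i
      ⟨Ideal.Quotient.mk J.toIdeal (homogeneousComponent i p),
        mem_quotGrading.2 ⟨_, homogeneousComponent_mem i p, rfl⟩⟩, ?_⟩
    rw [map_sum]
    simp only [DirectSum.coeAddMonoidHom_of]
    rw [← map_sum, sum_homogeneousComponent]

instance quotGrading.gradedAlgebra {K : Type*} [Field K] (J : HomogeneousIdeal (stdGrading K)) :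
    GradedAlgebra (quotGrading J) where
  toDecomposition := (quotGrading.isInternal J).chooseDecomposition

/-! ### Closed subschemes of `ℙ³`, their degree, and curves -/

/-- The closed subscheme `Proj (K[x, y, z, t] ⧸ J)` of `ℙ³` defined by a homogeneous
ideal `J`. -/
def projSubscheme {K : Type*} [Field K] (J : HomogeneousIdeal (stdGrading K)) : Scheme :=
  Proj (quotGrading J)

/-- `P` is the Hilbert polynomial of (the subscheme defined by) `J`: the dimension over `K` of the
degree `n` piece of `K[x, y, z, t] ⧸ J` is `P(n)` for all large `n`. -/
def HasHilbertPolynomial {K : Type*} [Field K] (J : HomogeneousIdeal (stdGrading K))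
    (P : Polynomial ℚ) : Prop :=
  ∀ᶠ n : ℕ in Filter.atTop, (Module.finrank K (quotGrading J n) : ℚ) = P.eval (n : ℚ)

/-- The subscheme defined by `J` is `r`-dimensional of degree `d`, as read off from the Hilbert
polynomial: that polynomial has degree `r` and leading coefficient `d / r!`. -/
def HasDegree {K : Type*} [Field K] (J : HomogeneousIdeal (stdGrading K)) (r : ℕ) (d : ℤ) :
    Prop :=
  ∃ P : Polynomial ℚ, HasHilbertPolynomial J P ∧ P ≠ 0 ∧ P.natDegree = r ∧
    (r.factorial : ℚ) * P.leadingCoeff = d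

/-- A (Noetherian) local ring is Cohen-Macaulay: its Krull dimension is the length of a regular
sequence. (A regular sequence on a local ring automatically lies in the maximal ideal.) -/
def IsCohenMacaulayLocal (A : Type*) [CommRing A] : Prop :=
  ∃ rs : List A, RingTheory.Sequence.IsRegular A rs ∧
    ((rs.length : ℕ) : WithBot ℕ∞) = ringKrullDim A

/-- A curve: a nonempty scheme, all of whose irreducible components have dimension one and all of
whose local rings are Cohen-Macaulay. -/
structure IsLocallyCMCurve (S : Scheme) : Prop where
  nonempty : Nonempty S
  pure_one_dimensional : ∀ Z ∈ irreducibleComponents S, topologicalKrullDim Z = 1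
  locally_cohenMacaulay : ∀ s : S, IsCohenMacaulayLocal (S.presheaf.stalk s)

/-! ### Minimal graded free resolutions -/

/-- `p` is homogeneous of degree `d ∈ ℤ`; the zero polynomial is homogeneous of every degree, and
it is the only one in negative degrees. -/
def IsHomogeneousOfDegree {K : Type*} [Field K] (p : CoordRing K) (d : ℤ) : Prop :=
  p = 0 ∨ ∃ n : ℕ, (n : ℤ) = d ∧ p.IsHomogeneous n

/-- The piece of degree `k` of the graded free module `⨁ i, R(-a i)`. -/
def freePiece {K : Type*} [Field K] {m : ℕ} (a : Fin m → ℤ) (k : ℤ) :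
    Set (Fin m → CoordRing K) :=
  {v | ∀ i, IsHomogeneousOfDegree (v i) (k - a i)}

/-- The matrix `M` gives a homomorphism `⨁ j, R(-b j) → ⨁ i, R(-a i)` of graded modules, i.e. one
which preserves degrees. -/
def IsGradedMap {K : Type*} [Field K] {m n : ℕ} (b : Fin n → ℤ) (a : Fin m → ℤ)
    (M : Matrix (Fin m) (Fin n) (CoordRing K)) : Prop :=
  ∀ (k : ℤ), ∀ v ∈ freePiece b k, M.mulVec v ∈ freePiece a k

/-- The homogeneous maximal ideal `(x, y, z, t)`. -/
def irrelevantMaxIdeal (K : Type*) [Field K] : Ideal (CoordRing K) :=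
  Ideal.span (Set.range X)

/-- The sequence `0 → ⨁ R(-a₃ i) → ⨁ R(-a₂ i) → ⨁ R(-a₁ i) → J → 0` with maps given by the
matrices `φ₃, φ₂, φ₁` (acting on column vectors) is a minimal graded free resolution of `J`: the
maps preserve degrees, the sequence is exact, and the images of `φ₂` and `φ₃` lie in
`(x, y, z, t)` times their targets. -/
structure IsMinimalGradedFreeResolution {K : Type*} [Field K] (J : Ideal (CoordRing K))
    {n₁ n₂ n₃ : ℕ} (a₁ : Fin n₁ → ℤ) (a₂ : Fin n₂ → ℤ) (a₃ : Fin n₃ → ℤ)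
    (φ₁ : Matrix (Fin 1) (Fin n₁) (CoordRing K))
    (φ₂ : Matrix (Fin n₁) (Fin n₂) (CoordRing K))
    (φ₃ : Matrix (Fin n₂) (Fin n₃) (CoordRing K)) : Prop where
  graded₁ : IsGradedMap a₁ (fun _ => 0) φ₁
  graded₂ : IsGradedMap a₂ a₁ φ₂
  graded₃ : IsGradedMap a₃ a₂ φ₃
  range₁ : ∀ p : CoordRing K, p ∈ J ↔ ∃ v, φ₁.mulVec v = ![p]
  exact₁ : Function.Exact φ₂.mulVec φ₁.mulVec
  exact₂ : Function.Exact φ₃.mulVec φ₂.mulVec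
  injective₃ : Function.Injective φ₃.mulVec
  minimal₂ : ∀ i j, φ₂ i j ∈ irrelevantMaxIdeal K
  minimal₃ : ∀ i j, φ₃ i j ∈ irrelevantMaxIdeal K

end

/-!
The curve `C` is, up to embedded structure, the union of the plane curves `x = g = 0` and
`y = f = 0`, where `f = xA + hF` and `g = yB + hG`.

*Resolution and degree.* Modulo `x` a syzygy of the four generators becomes a relation
`g (c y + d F) = 0`, and `g` is a nonzerodivisor modulo `x` because it is a nonzero polynomial in
`y, z, t`. Hence `d F ∈ (x, y)`, so `d ∈ (x, y)`, and the last two columns of `φ₂` reduce the syzygy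
to one that is visibly a combination of the first two (`CurveDatum.exists_of_syzygy`). The kernel of
`φ₂` is computed in the same way. The Hilbert polynomial is the alternating sum of the dimensions of
the graded pieces of the resolution
(`IsMinimalGradedFreeResolution.finrank_quotGrading`).

*Dimension.* Points of `C` are homogeneous primes other than `(x, y, z, t)` that contain `J`. They
have height at least two, since they contain a variable `x` or `y` and a further element, and
`(x, y, z, t)` has height four; so chains of points have length at most one. Conversely, `(x, q)`,
for a prime factor `q` of `g`, is the ideal of a nonclosed point by Krull's height theorem
(`exists_lt_of_span_pair`).

*Regular sequence implies curve.* The sequence `x, y, F, G` is regular if and only if `F` and `G` are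
relatively prime (`isRegular_X_X_iff_isRelPrime`), and then `x, y, F, G` have no common zero in `ℙ³`.
Always `(J : x) = (y, f)`, and where `F` or `y` is invertible `J + (x) = (x, g)`; so there `R ⧸ J`
is an extension of `R ⧸ (x, g)` by `R ⧸ (y, f)`, and a form vanishing on no component of either plane
curve is a nonzerodivisor (`CurveDatum.exists_mul_mem_of_F_or_y`). Where `G` or `x` is invertible the
same holds by symmetry. By prime avoidance there is such a form through any given closed point, so
all local rings at closed points have positive depth, which makes `C` Cohen-Macaulay and pure of
dimension one (`isLocallyCMCurve_of_exists_nonZeroDivisor`).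

*Curve implies regular sequence.* If `l` is a common prime factor of `F = l F₁` and `G = l G₁`, then
the annihilator of `x A G₁ + y B F₁ + h F G₁` modulo `J` is exactly `(x, y, l)` (`socle_mul_mem`,
`mem_of_socle_mul_mem`), so the local ring at the closed point `x = y = l = 0` has depth zero. On a
locally Cohen-Macaulay curve such a point would be a component of dimension zero
(`IsLocallyCMCurve.not_socle`).
-/

/-! ### Syzygies of the four generators over a domain -/

/-- The ideal `(xy, x²A + xhF, y²B + yhG, xAG + yBF + hFG)` of a commutative ring. -/
def curveIdeal {R : Type*} [CommRing R] (x y h F G A B : R) : Ideal R :=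
  Ideal.span {x * y, x ^ 2 * A + x * h * F, y ^ 2 * B + y * h * G,
    x * A * G + y * B * F + h * F * G}

/-- The regularity conditions under which the syzygies of the generators of `curveIdeal` are
computed: `x, y` is a regular sequence, `yB + hG` and `xA + hF` are nonzerodivisors modulo `x` and
`y` respectively, and `F`, `G` are nonzerodivisors modulo `(x, y)`. -/
structure CurveDatum {R : Type*} [CommRing R] (x y h F G A B : R) : Prop where
  x_ne_zero : x ≠ 0
  y_ne_zero : y ≠ 0
  dvd_of_dvd_y_mul : ∀ a, x ∣ y * a → x ∣ a
  dvd_of_dvd_x_mul : ∀ a, y ∣ x * a → y ∣ a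
  dvd_of_dvd_g_mul : ∀ a, x ∣ (y * B + h * G) * a → x ∣ a
  dvd_of_dvd_f_mul : ∀ a, y ∣ (x * A + h * F) * a → y ∣ a
  mem_of_F_mul_mem : ∀ a, F * a ∈ Ideal.span {x, y} → a ∈ Ideal.span {x, y}
  mem_of_G_mul_mem : ∀ a, G * a ∈ Ideal.span {x, y} → a ∈ Ideal.span {x, y}

theorem mem_curveIdeal {R : Type*} [CommRing R] {x y h F G A B p : R} :
    p ∈ curveIdeal x y h F G A B ↔ ∃ a b c d, p = a * (x * y) + b * (x ^ 2 * A + x * h * F) +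
      c * (y ^ 2 * B + y * h * G) + d * (x * A * G + y * B * F + h * F * G) := by
  simp only [curveIdeal, Ideal.mem_span_insert, Ideal.mem_span_singleton']
  constructor
  · rintro ⟨a, _, ⟨b, _, ⟨c, _, ⟨d, rfl⟩, rfl⟩, rfl⟩, rfl⟩
    exact ⟨a, b, c, d, by ring⟩
  · rintro ⟨a, b, c, d, rfl⟩
    exact ⟨a, _, ⟨b, _, ⟨c, _, ⟨d, rfl⟩, rfl⟩, rfl⟩, by ring⟩

/-- Exchanging the two planes `x = 0` and `y = 0` exchanges the roles of `F, A` and `G, B`. -/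
theorem curveIdeal_swap {R : Type*} [CommRing R] (x y h F G A B : R) :
    curveIdeal y x h G F B A = curveIdeal x y h F G A B := by
  ext p
  simp only [mem_curveIdeal]
  constructor <;> rintro ⟨a, b, c, d, rfl⟩ <;> exact ⟨a, c, b, d, by ring⟩

/-- `V(J)` contains the plane curve `x = yB + hG = 0`. -/
theorem curveIdeal_le_span_x {R : Type*} [CommRing R] (x y h F G A B : R) :
    curveIdeal x y h F G A B ≤ Ideal.span {x, y * B + h * G} := by
  intro p hp
  obtain ⟨a, b, c, d, rfl⟩ := mem_curveIdeal.1 hp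
  exact Ideal.mem_span_pair.2
    ⟨a * y + b * (x * A + h * F) + d * A * G, c * y + d * F, by ring⟩

namespace CurveDatum

variable {R : Type*} [CommRing R] {x y h F G A B : R}

theorem swap (D : CurveDatum x y h F G A B) : CurveDatum y x h G F B A where
  x_ne_zero := D.y_ne_zero
  y_ne_zero := D.x_ne_zero
  dvd_of_dvd_y_mul := D.dvd_of_dvd_x_mul
  dvd_of_dvd_x_mul := D.dvd_of_dvd_y_mul
  dvd_of_dvd_g_mul := D.dvd_of_dvd_f_mul
  dvd_of_dvd_f_mul := D.dvd_of_dvd_g_mul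
  mem_of_F_mul_mem := by rw [Set.pair_comm]; exact D.mem_of_G_mul_mem
  mem_of_G_mul_mem := by rw [Set.pair_comm]; exact D.mem_of_F_mul_mem

/-- The syzygies of the four generators are generated by the columns of `φ₂`: reducing a syzygy
modulo `x` and cancelling `yB + hG` shows that its last coefficient lies in `(x, y)`, so that it can
be made zero by means of the last two columns. -/
theorem exists_of_syzygy [IsDomain R] (D : CurveDatum x y h F G A B) {a b c d : R}
    (H : a * (x * y) + b * (x ^ 2 * A + x * h * F) + c * (y ^ 2 * B + y * h * G) +
      d * (x * A * G + y * B * F + h * F * G) = 0) :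
    ∃ u₀ u₁ u₂ u₃, a = (x * A + h * F) * u₀ + (y * B + h * G) * u₁ + A * G * u₂ + B * F * u₃ ∧
      b = -y * u₀ + G * u₃ ∧ c = -x * u₁ + F * u₂ ∧ d = -y * u₂ + -x * u₃ := by
  obtain ⟨e₁, he₁⟩ := D.dvd_of_dvd_g_mul (c * y + d * F)
    ⟨-(a * y + b * (x * A + h * F) + d * A * G), by linear_combination H⟩
  obtain ⟨e₂, he₂⟩ := D.dvd_of_dvd_f_mul (b * x + d * G)
    ⟨-(a * x + c * (y * B + h * G) + d * B * F), by linear_combination H⟩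
  obtain ⟨p, q, hpq⟩ := Ideal.mem_span_pair.1 (D.mem_of_F_mul_mem d
    (Ideal.mem_span_pair.2 ⟨e₁, -c, by linear_combination -he₁⟩))
  obtain ⟨u₁, hu₁⟩ := D.dvd_of_dvd_y_mul (c + q * F) ⟨e₁ - p * F, by
    linear_combination he₁ + F * hpq⟩
  obtain ⟨u₀, hu₀⟩ := D.dvd_of_dvd_x_mul (b + p * G) ⟨e₂ - q * G, by
    linear_combination he₂ + G * hpq⟩
  refine ⟨-u₀, -u₁, -q, -p, ?_, by linear_combination hu₀, by linear_combination hu₁,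
    by linear_combination -hpq⟩
  apply mul_right_cancel₀ (mul_ne_zero D.x_ne_zero D.y_ne_zero)
  linear_combination H - x * (x * A + h * F) * hu₀ - y * (y * B + h * G) * hu₁ +
    (x * A * G + y * B * F + h * F * G) * hpq

/-- The columns of `φ₂` have, up to multiples, the single syzygy `φ₃`. -/
theorem exists_of_second_syzygy [IsDomain R] (D : CurveDatum x y h F G A B) {u₀ u₁ u₂ u₃ : R}
    (h₁ : -y * u₀ + G * u₃ = 0) (h₂ : -x * u₁ + F * u₂ = 0) (h₃ : -y * u₂ + -x * u₃ = 0) :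
    ∃ w, u₀ = G * w ∧ u₁ = -F * w ∧ u₂ = -x * w ∧ u₃ = y * w := by
  obtain ⟨w, hw⟩ := D.dvd_of_dvd_x_mul u₃ ⟨-u₂, by linear_combination -h₃⟩
  have h₂' : u₂ = -x * w := mul_left_cancel₀ D.y_ne_zero
    (by linear_combination -h₃ - x * hw)
  refine ⟨w, mul_left_cancel₀ D.y_ne_zero (by linear_combination -h₁ + G * hw),
    mul_left_cancel₀ D.x_ne_zero (by linear_combination -h₂ + F * h₂'), h₂', hw⟩

/-- `(J : x) = (y, xA + hF)`, the ideal of the part of the curve in the plane `y = 0`. -/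
theorem mem_of_x_mul_mem [IsDomain R] (D : CurveDatum x y h F G A B) {a : R}
    (ha : x * a ∈ curveIdeal x y h F G A B) : a ∈ Ideal.span {y, x * A + h * F} := by
  obtain ⟨b, c, e, d, H⟩ := mem_curveIdeal.1 ha
  obtain ⟨k, hk⟩ := D.dvd_of_dvd_g_mul (e * y + d * F)
    ⟨a - b * y - c * (x * A + h * F) - d * A * G, by linear_combination -H⟩
  obtain ⟨q, r, hqr⟩ := Ideal.mem_span_pair.1 (D.mem_of_F_mul_mem d
    (Ideal.mem_span_pair.2 ⟨k, -e, by linear_combination -hk⟩))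
  obtain ⟨m, hm⟩ := D.dvd_of_dvd_y_mul (e + r * F) ⟨k - q * F, by
    linear_combination hk + F * hqr⟩
  refine Ideal.mem_span_pair.2 ⟨b + m * (y * B + h * G) + q * B * F + r * A * G, c + q * G, ?_⟩
  apply mul_left_cancel₀ D.x_ne_zero
  linear_combination -H - y * (y * B + h * G) * hm +
    (x * A * G + y * B * F + h * F * G) * hqr

theorem x_mul_mem {a : R} (ha : a ∈ Ideal.span {y, x * A + h * F}) :
    x * a ∈ curveIdeal x y h F G A B := by
  obtain ⟨p, q, rfl⟩ := Ideal.mem_span_pair.1 ha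
  exact mem_curveIdeal.2 ⟨p, q, 0, 0, by ring⟩

/-- A common nonzerodivisor `l` of the two plane curves `(y, xA + hF)` and `(x, yB + hG)` is a
nonzerodivisor on the quotient by `J` where `F` or `y` is invertible, because there that quotient is
an extension of the second curve by the first one. -/
theorem exists_mul_mem_of_F_or_y [IsDomain R] (D : CurveDatum x y h F G A B) {l : R}
    (hf : ∀ a, l * a ∈ Ideal.span {y, x * A + h * F} → a ∈ Ideal.span {y, x * A + h * F})
    (hg : ∀ a, l * a ∈ Ideal.span {x, y * B + h * G} → a ∈ Ideal.span {x, y * B + h * G})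
    {w : R} (hw : w = F ∨ w = y) {a : R} (ha : l * a ∈ curveIdeal x y h F G A B) :
    w * a ∈ curveIdeal x y h F G A B := by
  obtain ⟨b, k, hbk⟩ := Ideal.mem_span_pair.1 (hg a (curveIdeal_le_span_x _ _ _ _ _ _ _ ha))
  -- modulo `J`, both `F * (yB + hG)` and `y * (yB + hG)` are multiples of `x`
  obtain ⟨c, hc⟩ : ∃ c, w * a - x * c ∈ curveIdeal x y h F G A B := by
    rcases hw with rfl | rfl
    · exact ⟨w * b - k * A * G, mem_curveIdeal.2 ⟨0, 0, 0, k, by rw [← hbk]; ring⟩⟩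
    · exact ⟨0, mem_curveIdeal.2 ⟨b, 0, k, 0, by rw [← hbk]; ring⟩⟩
  have h1 : x * (l * c) ∈ curveIdeal x y h F G A B := by
    have := sub_mem (Ideal.mul_mem_left _ w ha) (Ideal.mul_mem_left _ l hc)
    convert this using 1
    ring
  have h2 := x_mul_mem (G := G) (B := B) (hf c (D.mem_of_x_mul_mem h1))
  simpa using add_mem hc h2

end CurveDatum

/-- A common factor `l` of `F` and `G` produces an element that is killed by `x`, `y` and `l` modulo
`J`. -/
theorem socle_mul_mem {R : Type*} [CommRing R] (x y h F G A B l : R) {p : R}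
    (hp : p ∈ Ideal.span {x, y, l}) :
    (x * A * G + y * B * F + h * (l * F) * G) * p ∈ curveIdeal x y h (l * F) (l * G) A B := by
  simp only [Ideal.mem_span_insert, Ideal.mem_span_singleton'] at hp
  obtain ⟨a, _, ⟨b, _, ⟨c, rfl⟩, rfl⟩, rfl⟩ := hp
  exact mem_curveIdeal.2 ⟨a * B * F + b * A * G, a * G, b * F, c, by ring⟩

/-- The annihilator modulo `J` of the element of `socle_mul_mem` is contained in `(x, y, l)`. -/
theorem mem_of_socle_mul_mem {R : Type*} [CommRing R] [IsDomain R] {x y h F G A B l : R}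
    (D : CurveDatum x y h (l * F) (l * G) A B) {p : R}
    (hp : (x * A * G + y * B * F + h * (l * F) * G) * p ∈ curveIdeal x y h (l * F) (l * G) A B) :
    p ∈ Ideal.span {x, y, l} := by
  obtain ⟨a, b, c, d, H⟩ := mem_curveIdeal.1 hp
  obtain ⟨u₀, u₁, u₂, u₃, -, -, -, hd⟩ := D.exists_of_syzygy (a := l * a) (b := l * b)
    (c := l * c) (d := l * d - p) (by linear_combination -l * H)
  simp only [Ideal.mem_span_insert, Ideal.mem_span_singleton']
  exact ⟨u₃, _, ⟨u₂, _, ⟨d, rfl⟩, rfl⟩, by linear_combination -hd⟩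

/-! ### Setting variables to zero -/

section KillVars

variable {σ K : Type*} [Field K]

open Classical in
/-- The substitution setting the variables in `s` to zero. -/
noncomputable def killVars (K : Type*) [Field K] (s : Set σ) :
    MvPolynomial σ K →ₐ[K] MvPolynomial σ K :=
  aeval fun i => if i ∈ s then 0 else X i

theorem killVars_X_of_mem {s : Set σ} {i : σ} (hi : i ∈ s) : killVars K s (X i) = 0 := by
  simp [killVars, hi]

theorem killVars_X_of_notMem {s : Set σ} {i : σ} (hi : i ∉ s) : killVars K s (X i) = X i := by
  simp [killVars, hi]

theorem killVars_of_mem_supported {s t : Set σ} (hst : Disjoint s t) {p : MvPolynomial σ K}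
    (hp : p ∈ supported K t) : killVars K s p = p := by
  have h : (killVars K s : MvPolynomial σ K →+* MvPolynomial σ K) p =
      (RingHom.id (MvPolynomial σ K)) p := by
    refine hom_congr_vars (by ext; simp) (fun i hi _ => ?_) rfl
    have : i ∉ s := fun h => Set.disjoint_left.1 hst h (mem_supported.1 hp hi)
    simpa using killVars_X_of_notMem (K := K) this
  simpa using h

theorem killVars_of_mem_supported_compl {s : Set σ} {p : MvPolynomial σ K}
    (hp : p ∈ supported K sᶜ) : killVars K s p = p :=
  killVars_of_mem_supported disjoint_compl_right hp

theorem sub_killVars_mem (s : Set σ) (p : MvPolynomial σ K) :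
    p - killVars K s p ∈ Ideal.span (X '' s) := by
  rw [← Ideal.Quotient.mk_eq_mk_iff_sub_mem]
  have h : (Ideal.Quotient.mkₐ K (Ideal.span (X '' s))).comp (killVars K s) =
      Ideal.Quotient.mkₐ K (Ideal.span (X '' s : Set (MvPolynomial σ K))) := by
    ext i
    by_cases hi : i ∈ s
    · have : X i ∈ Ideal.span (X '' s : Set (MvPolynomial σ K)) :=
        Ideal.subset_span ⟨i, hi, rfl⟩
      simp [killVars_X_of_mem hi, Ideal.Quotient.eq_zero_iff_mem.2 this]
    · simp [killVars_X_of_notMem hi]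
  exact (DFunLike.congr_fun h p).symm

theorem mem_span_X_image_iff_killVars {s : Set σ} {p : MvPolynomial σ K} :
    p ∈ Ideal.span (X '' s) ↔ killVars K s p = 0 := by
  refine ⟨fun hp => ?_, fun hp => by simpa [hp] using sub_killVars_mem s p⟩
  have : Ideal.span (X '' s) ≤ RingHom.ker (killVars K s) := by
    rw [Ideal.span_le]
    rintro _ ⟨i, hi, rfl⟩
    exact killVars_X_of_mem hi
  exact this hp

theorem isPrime_span_X_image (K : Type*) [Field K] (s : Set σ) :
    (Ideal.span (X '' s : Set (MvPolynomial σ K))).IsPrime := by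
  have : Ideal.span (X '' s : Set (MvPolynomial σ K)) = RingHom.ker (killVars K s) := by
    ext p
    exact mem_span_X_image_iff_killVars
  rw [this]
  exact RingHom.ker_isPrime _

theorem X_dvd_iff_killVars {i : σ} {p : MvPolynomial σ K} :
    X i ∣ p ↔ killVars K {i} p = 0 := by
  rw [← mem_span_X_image_iff_killVars, Set.image_singleton, Ideal.mem_span_singleton]

theorem mem_span_X_pair_iff_killVars {i j : σ} {p : MvPolynomial σ K} :
    p ∈ Ideal.span {X i, X j} ↔ killVars K {i, j} p = 0 := by
  rw [← mem_span_X_image_iff_killVars, Set.image_pair]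

/-- Membership in `(s) + (q)`, where `s` is a set of variables which do not occur in `q`. -/
theorem mem_span_X_image_sup_iff {s : Set σ} {p q : MvPolynomial σ K}
    (hq : killVars K s q = q) :
    p ∈ Ideal.span (X '' s) ⊔ Ideal.span {q} ↔ q ∣ killVars K s p := by
  constructor
  · intro hp
    obtain ⟨a, ha, b, hb, rfl⟩ := Submodule.mem_sup.1 hp
    obtain ⟨c, rfl⟩ := Ideal.mem_span_singleton.1 hb
    rw [map_add, mem_span_X_image_iff_killVars.1 ha, map_mul, hq, zero_add]
    exact dvd_mul_right _ _
  · intro hp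
    have h1 := sub_killVars_mem s p
    rw [← sub_add_cancel p (killVars K s p)]
    exact Submodule.add_mem_sup h1 (Ideal.mem_span_singleton.2 hp)

/-- `(s) + (q)` is prime if `q` is a prime polynomial in the variables outside `s`. -/
theorem isPrime_span_X_image_sup {s : Set σ} {q : MvPolynomial σ K} (hq : killVars K s q = q)
    (hprime : Prime q) : (Ideal.span (X '' s) ⊔ Ideal.span {q}).IsPrime := by
  refine Ideal.isPrime_iff.2 ⟨fun h => ?_, fun {a b} hab => ?_⟩
  · rw [Ideal.eq_top_iff_one, mem_span_X_image_sup_iff hq, map_one] at h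
    exact hprime.not_isUnit (isUnit_of_dvd_one h)
  · rw [mem_span_X_image_sup_iff hq, map_mul] at hab
    simpa only [mem_span_X_image_sup_iff hq] using hprime.dvd_or_dvd hab

/-- A divisor of a nonzero polynomial not involving the variables in `s` does not involve them
either. -/
theorem killVars_eq_of_dvd {s : Set σ} {p q : MvPolynomial σ K} (hp : p ≠ 0)
    (hps : p ∈ supported K sᶜ) (hq : q ∣ p) : killVars K s q = q := by
  refine killVars_of_mem_supported_compl (mem_supported.2 ?_)
  obtain ⟨r, rfl⟩ := hq
  intro i hi
  refine mem_supported.1 hps ?_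
  simp only [Finset.mem_coe, mem_vars_iff_degreeOf_ne_zero] at hi ⊢
  rw [degreeOf_mul_eq (left_ne_zero_of_mul hp) (right_ne_zero_of_mul hp)]
  omega

end KillVars

/-! ### Factors of homogeneous polynomials -/

/-- The grading of the polynomial ring as a homomorphism `p ↦ ∑ pₙ Tⁿ`. -/
noncomputable def homogenizeHom (σ K : Type*) [Field K] :
    MvPolynomial σ K →ₐ[K] Polynomial (MvPolynomial σ K) :=
  aeval fun i => Polynomial.C (X i) * Polynomial.X

theorem homogenizeHom_of_isHomogeneous {σ K : Type*} [Field K] {p : MvPolynomial σ K} {n : ℕ}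
    (hp : p.IsHomogeneous n) : homogenizeHom σ K p = Polynomial.C p * Polynomial.X ^ n := by
  rw [p.as_sum, map_sum, map_sum, Finset.sum_mul]
  refine Finset.sum_congr rfl fun d hd => ?_
  have hdeg : d.degree = n := by
    rw [Finsupp.degree_eq_weight_one]; exact hp (mem_support_iff.1 hd)
  rw [homogenizeHom, aeval_monomial, monomial_eq, map_mul]
  simp only [Finsupp.prod, mul_pow, Finset.prod_mul_distrib, Finset.prod_pow_eq_pow_sum, map_prod,
    map_pow]
  rw [← Finsupp.degree_apply, hdeg, mul_assoc]
  rfl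

theorem coeff_homogenizeHom {σ K : Type*} [Field K] (p : MvPolynomial σ K) (n : ℕ) :
    (homogenizeHom σ K p).coeff n = homogeneousComponent n p := by
  conv_lhs => rw [← sum_homogeneousComponent p]
  rw [map_sum, Polynomial.finsetSum_coeff]
  simp only [homogenizeHom_of_isHomogeneous (homogeneousComponent_isHomogeneous _ p),
    Polynomial.coeff_C_mul, Polynomial.coeff_X_pow, mul_ite, mul_one, mul_zero]
  rw [Finset.sum_ite_eq]
  split_ifs with h
  · rfl
  · exact (homogeneousComponent_eq_zero n p (by simpa using h)).symm

/-- A factor of a nonzero homogeneous polynomial is homogeneous: by `homogenizeHom`, this reduces to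
the fact that a factor of a monomial `aTⁿ` over a domain is a monomial. -/
theorem MvPolynomial.IsHomogeneous.exists_of_dvd {σ K : Type*} [Field K] {p q : MvPolynomial σ K}
    {n : ℕ} (hp : p.IsHomogeneous n) (hp0 : p ≠ 0) (hq : q ∣ p) : ∃ m, q.IsHomogeneous m := by
  obtain ⟨r, rfl⟩ := hq
  have h := homogenizeHom_of_isHomogeneous hp
  have hne : homogenizeHom σ K (q * r) ≠ 0 := by
    rw [h]; exact mul_ne_zero (by simpa using hp0) (pow_ne_zero _ Polynomial.X_ne_zero)
  have h1 : (homogenizeHom σ K (q * r)).natDegree = n := by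
    rw [h]; exact Polynomial.natDegree_C_mul_X_pow _ _ hp0
  have h2 : (homogenizeHom σ K (q * r)).natTrailingDegree = n := by
    rw [h, Polynomial.C_mul_X_pow_eq_monomial]
    exact Polynomial.natTrailingDegree_monomial hp0
  rw [map_mul] at hne h1 h2
  have hq0 := left_ne_zero_of_mul hne
  have hr0 := right_ne_zero_of_mul hne
  rw [Polynomial.natDegree_mul hq0 hr0] at h1
  rw [Polynomial.natTrailingDegree_mul hq0 hr0] at h2
  have h3 := Polynomial.natTrailingDegree_le_natDegree (homogenizeHom σ K q)
  have h4 := Polynomial.natTrailingDegree_le_natDegree (homogenizeHom σ K r)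
  set e := (homogenizeHom σ K q).natDegree with he
  refine ⟨e, ?_⟩
  have h5 : ∀ m, m ≠ e → homogeneousComponent m q = 0 := by
    intro m hm
    rw [← coeff_homogenizeHom]
    rcases lt_or_gt_of_ne hm with hm | hm
    · exact Polynomial.coeff_eq_zero_of_lt_natTrailingDegree (by omega)
    · exact Polynomial.coeff_eq_zero_of_natDegree_lt hm
  have h6 : q = homogeneousComponent e q := by
    conv_lhs => rw [← sum_homogeneousComponent q]
    refine Finset.sum_eq_single e (fun m _ hm => h5 m hm) fun hm => ?_
    exact homogeneousComponent_eq_zero e q (by simpa using hm)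
  rw [h6]
  exact homogeneousComponent_isHomogeneous e q

/-! ### The four forms in `K[x, y, z, t]` and the regular sequence `x, y, F, G` -/

section

variable {K : Type*} [Field K] {h F G A B : CoordRing K}

theorem ne_zero_of_notMem_range_C (hF' : F ∉ Set.range (C : K → CoordRing K)) : F ≠ 0 := by
  rintro rfl
  exact hF' ⟨0, map_zero _⟩

theorem pos_of_notMem_range_C {d : ℕ} (hF' : F ∉ Set.range (C : K → CoordRing K))
    (hFdeg : F.IsHomogeneous d) : 0 < d := by
  rw [Nat.pos_iff_ne_zero]
  rintro rfl
  have := hFdeg.totalDegree (ne_zero_of_notMem_range_C hF')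
  exact hF' ⟨_, (totalDegree_eq_zero_iff_eq_C.1 this).symm⟩

theorem g_mem_supported (hh : h ∈ supported K ({2, 3} : Set (Fin 4)))
    (hG : G ∈ supported K ({2, 3} : Set (Fin 4)))
    (hB : B ∈ supported K ({1, 2, 3} : Set (Fin 4))) :
    X 1 * B + h * G ∈ supported K ({0}ᶜ : Set (Fin 4)) := by
  have h1 : supported K ({2, 3} : Set (Fin 4)) ≤ supported K {0}ᶜ := supported_mono (by simp)
  have h2 : supported K ({1, 2, 3} : Set (Fin 4)) ≤ supported K {0}ᶜ := supported_mono (by simp)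
  exact add_mem (mul_mem (X_mem_supported.2 (by simp)) (h2 hB)) (mul_mem (h1 hh) (h1 hG))

theorem f_mem_supported (hh : h ∈ supported K ({2, 3} : Set (Fin 4)))
    (hF : F ∈ supported K ({2, 3} : Set (Fin 4)))
    (hA : A ∈ supported K ({0, 2, 3} : Set (Fin 4))) :
    X 0 * A + h * F ∈ supported K ({1}ᶜ : Set (Fin 4)) := by
  have h1 : supported K ({2, 3} : Set (Fin 4)) ≤ supported K {1}ᶜ := supported_mono (by simp)
  have h2 : supported K ({0, 2, 3} : Set (Fin 4)) ≤ supported K {1}ᶜ := supported_mono (by simp)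
  exact add_mem (mul_mem (X_mem_supported.2 (by simp)) (h2 hA)) (mul_mem (h1 hh) (h1 hF))

/-- A form `Xᵢ * B + h * G` with `h * G` not involving `Xᵢ` does not vanish if `h * G ≠ 0`, or if
`h = 0` and `B ≠ 0`. -/
theorem X_mul_add_ne_zero {i : Fin 4} (hi : i ∉ ({2, 3} : Set (Fin 4)))
    (hh : h ∈ supported K ({2, 3} : Set (Fin 4)))
    (hG : G ∈ supported K ({2, 3} : Set (Fin 4))) (hG0 : G ≠ 0) (hB0 : h = 0 → B ≠ 0) :
    X i * B + h * G ≠ 0 := by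
  intro h0
  by_cases hh0 : h = 0
  · rw [hh0, zero_mul, add_zero] at h0
    exact mul_ne_zero (X_ne_zero i) (hB0 hh0) h0
  · have := congrArg (killVars K {i}) h0
    rw [map_add, map_mul, map_mul, killVars_X_of_mem (Set.mem_singleton i),
      killVars_of_mem_supported (by simpa using hi) hh,
      killVars_of_mem_supported (by simpa using hi) hG, map_zero, zero_mul, zero_add] at this
    exact mul_ne_zero hh0 hG0 this

theorem curveDatum (hh : h ∈ supported K ({2, 3} : Set (Fin 4)))
    (hF : F ∈ supported K ({2, 3} : Set (Fin 4))) (hG : G ∈ supported K ({2, 3} : Set (Fin 4)))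
    (hA : A ∈ supported K ({0, 2, 3} : Set (Fin 4)))
    (hB : B ∈ supported K ({1, 2, 3} : Set (Fin 4))) (hF0 : F ≠ 0) (hG0 : G ≠ 0)
    (hAB : h = 0 → A * B ≠ 0) : CurveDatum (X 0) (X 1) h F G A B where
  x_ne_zero := X_ne_zero _
  y_ne_zero := X_ne_zero _
  dvd_of_dvd_y_mul a ha := by
    rw [X_dvd_iff_killVars, map_mul, killVars_X_of_notMem (by simp)] at ha
    exact X_dvd_iff_killVars.2 ((mul_eq_zero.1 ha).resolve_left (X_ne_zero _))
  dvd_of_dvd_x_mul a ha := by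
    rw [X_dvd_iff_killVars, map_mul, killVars_X_of_notMem (by simp)] at ha
    exact X_dvd_iff_killVars.2 ((mul_eq_zero.1 ha).resolve_left (X_ne_zero _))
  dvd_of_dvd_g_mul a ha := by
    rw [X_dvd_iff_killVars, map_mul,
      killVars_of_mem_supported_compl (g_mem_supported hh hG hB)] at ha
    exact X_dvd_iff_killVars.2 ((mul_eq_zero.1 ha).resolve_left
      (X_mul_add_ne_zero (by simp) hh hG hG0 fun h0 => right_ne_zero_of_mul (hAB h0)))
  dvd_of_dvd_f_mul a ha := by
    rw [X_dvd_iff_killVars, map_mul,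
      killVars_of_mem_supported_compl (f_mem_supported hh hF hA)] at ha
    exact X_dvd_iff_killVars.2 ((mul_eq_zero.1 ha).resolve_left
      (X_mul_add_ne_zero (by simp) hh hF hF0 fun h0 => left_ne_zero_of_mul (hAB h0)))
  mem_of_F_mul_mem a ha := by
    rw [mem_span_X_pair_iff_killVars, map_mul, killVars_of_mem_supported (by simp) hF] at ha
    exact mem_span_X_pair_iff_killVars.2 ((mul_eq_zero.1 ha).resolve_left hF0)
  mem_of_G_mul_mem a ha := by
    rw [mem_span_X_pair_iff_killVars, map_mul, killVars_of_mem_supported (by simp) hG] at ha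
    exact mem_span_X_pair_iff_killVars.2 ((mul_eq_zero.1 ha).resolve_left hG0)

theorem RingTheory.Sequence.isWeaklyRegular_self_iff {R : Type*} [CommRing R] (rs : List R) :
    RingTheory.Sequence.IsWeaklyRegular R rs ↔ ∀ i (hi : i < rs.length) (a : R),
      rs[i] * a ∈ Ideal.ofList (rs.take i) → a ∈ Ideal.ofList (rs.take i) := by
  simp only [RingTheory.Sequence.isWeaklyRegular_iff, isSMulRegular_quotient_iff_mem_of_smul_mem,
    smul_eq_mul, Ideal.mul_top]

theorem mem_span_X_X_iff (hF : F ∈ supported K ({2, 3} : Set (Fin 4))) {p : CoordRing K} :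
    p ∈ Ideal.span {X 0, X 1, F} ↔ F ∣ killVars K {0, 1} p := by
  rw [← mem_span_X_image_sup_iff (killVars_of_mem_supported (by simp) hF), Set.image_pair,
    ← Ideal.span_union]
  congr! 2
  ext; simp; tauto

theorem isRegular_X_X_iff_isRelPrime {dF dG : ℕ} (hF : F ∈ supported K ({2, 3} : Set (Fin 4)))
    (hG : G ∈ supported K ({2, 3} : Set (Fin 4))) (hF0 : F ≠ 0)
    (hFdeg : F.IsHomogeneous dF) (hGdeg : G.IsHomogeneous dG) (hdF : 0 < dF) (hdG : 0 < dG) :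
    RingTheory.Sequence.IsRegular (CoordRing K) [X 0, X 1, F, G] ↔ IsRelPrime F G := by
  have kF := killVars_of_mem_supported (s := {0, 1}) (by simp) hF
  have kG := killVars_of_mem_supported (s := {0, 1}) (by simp) hG
  have hl : Ideal.ofList [X 0, X 1, F] = Ideal.span {X 0, X 1, F} := by
    simp [Ideal.ofList, Set.insert_def]
  constructor
  · intro H d hdF hdG
    obtain ⟨F₁, rfl⟩ := hdF
    obtain ⟨G₁, rfl⟩ := hdG
    have h1 := (RingTheory.Sequence.isWeaklyRegular_self_iff _).1 H.toIsWeaklyRegular 3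
      (by simp) F₁
    simp only [List.take_succ_cons, List.take_zero, List.getElem_cons_succ,
      List.getElem_cons_zero, hl] at h1
    have h2 := h1 (by
      rw [show d * G₁ * F₁ = G₁ * (d * F₁) by ring]
      exact Ideal.mul_mem_left _ _ (Ideal.subset_span (by simp)))
    obtain ⟨c, hc⟩ := (mem_span_X_X_iff hF).1 h2
    rw [killVars_eq_of_dvd (s := {0, 1}) hF0 _ (dvd_mul_left F₁ d)] at hc
    · exact isUnit_iff_dvd_one.2 ⟨c, mul_left_cancel₀ (right_ne_zero_of_mul hF0)
        (by linear_combination hc)⟩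
    · exact supported_mono (by intro i; fin_cases i <;> simp) hF
  · intro H
    refine ⟨(RingTheory.Sequence.isWeaklyRegular_self_iff _).2 fun i hi a ha => ?_, ?_⟩
    · simp only [List.length_cons, List.length_nil, zero_add, Nat.reduceAdd] at hi
      interval_cases i
      · simpa using ha
      · simp only [List.take_succ_cons, List.take_zero, List.getElem_cons_succ,
          List.getElem_cons_zero, Ideal.ofList_singleton, Ideal.mem_span_singleton,
          X_dvd_iff_killVars, map_mul] at ha ⊢
        rw [killVars_X_of_notMem (by simp)] at ha
        exact (mul_eq_zero.1 ha).resolve_left (X_ne_zero _)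
      · have hl2 : Ideal.ofList [X 0, X 1] = Ideal.span {X 0, (X 1 : CoordRing K)} := by
          simp [Ideal.ofList, Set.insert_def]
        simp only [List.take_succ_cons, List.take_zero, List.getElem_cons_succ,
          List.getElem_cons_zero, hl2, mem_span_X_pair_iff_killVars, map_mul, kF] at ha ⊢
        exact (mul_eq_zero.1 ha).resolve_left hF0
      · simp only [List.take_succ_cons, List.take_zero, List.getElem_cons_succ,
          List.getElem_cons_zero, hl, mem_span_X_X_iff hF, map_mul, kG] at ha ⊢
        exact H.dvd_of_dvd_mul_left ha
    · rw [Ideal.smul_top_eq_map, Algebra.algebraMap_self, Ideal.map_id]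
      intro htop
      have hle : Ideal.ofList [X 0, X 1, F, G] ≤
          RingHom.ker (constantCoeff : CoordRing K →+* K) := by
        have aux {p : CoordRing K} {d : ℕ} (hp : p.IsHomogeneous d) (hd : 0 < d) :
            constantCoeff p = 0 := hp.coeff_eq_zero (by simpa using hd.ne)
        rw [Ideal.ofList, Ideal.span_le]
        intro p hp
        simp only [List.mem_cons, List.not_mem_nil, or_false, Set.mem_ofPred_eq] at hp
        rcases hp with rfl | rfl | rfl | rfl
        · simp
        · simp
        · exact aux hFdeg hdF
        · exact aux hGdeg hdG
      have h1 : (1 : CoordRing K) ∈ Ideal.ofList [X 0, X 1, F, G] := by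
        have h2 : (1 : CoordRing K) ∈ (⊤ : Submodule (CoordRing K) (CoordRing K)) := trivial
        rwa [htop] at h2
      simpa using hle h1

end

/-! ### Homogeneity in integer degrees -/

section IntDegree

variable {K : Type*} [Field K]

namespace IsHomogeneousOfDegree

theorem of_isHomogeneous {p : CoordRing K} {n : ℕ} (hp : p.IsHomogeneous n) :
    IsHomogeneousOfDegree p n := Or.inr ⟨n, rfl, hp⟩

theorem zero (d : ℤ) : IsHomogeneousOfDegree (0 : CoordRing K) d := Or.inl rfl

theorem X (i : Fin 4) : IsHomogeneousOfDegree (X i : CoordRing K) 1 :=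
  Or.inr ⟨1, rfl, isHomogeneous_X K i⟩

theorem mul {p q : CoordRing K} {d e : ℤ} (hp : IsHomogeneousOfDegree p d)
    (hq : IsHomogeneousOfDegree q e) : IsHomogeneousOfDegree (p * q) (d + e) := by
  rcases hp with rfl | ⟨m, rfl, hm⟩
  · exact Or.inl (zero_mul _)
  rcases hq with rfl | ⟨n, rfl, hn⟩
  · exact Or.inl (mul_zero _)
  exact Or.inr ⟨m + n, by push_cast; rfl, hm.mul hn⟩

theorem add {p q : CoordRing K} {d : ℤ} (hp : IsHomogeneousOfDegree p d)
    (hq : IsHomogeneousOfDegree q d) : IsHomogeneousOfDegree (p + q) d := by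
  rcases hp with rfl | ⟨m, rfl, hm⟩
  · rwa [zero_add]
  rcases hq with rfl | ⟨n, hnm, hn⟩
  · rw [add_zero]; exact Or.inr ⟨m, rfl, hm⟩
  · obtain rfl : n = m := by exact_mod_cast hnm
    exact Or.inr ⟨n, rfl, hm.add hn⟩

theorem neg {p : CoordRing K} {d : ℤ} (hp : IsHomogeneousOfDegree p d) :
    IsHomogeneousOfDegree (-p) d := by
  rcases hp with rfl | ⟨m, rfl, hm⟩
  · exact Or.inl neg_zero
  · exact Or.inr ⟨m, rfl, hm.neg⟩

theorem congr {p : CoordRing K} {d e : ℤ} (hp : IsHomogeneousOfDegree p d) (h : d = e) :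
    IsHomogeneousOfDegree p e := h ▸ hp

theorem sum {ι : Type*} (s : Finset ι) {p : ι → CoordRing K} {d : ℤ}
    (hp : ∀ i ∈ s, IsHomogeneousOfDegree (p i) d) : IsHomogeneousOfDegree (∑ i ∈ s, p i) d := by
  classical
  induction s using Finset.induction_on with
  | empty => exact Or.inl Finset.sum_empty
  | insert i s hi ih =>
    rw [Finset.sum_insert hi]
    exact (hp i (by simp)).add (ih fun j hj => hp j (by simp [hj]))

/-- A form of positive degree lies in the ideal of the variables. -/
theorem mem_irrelevantMaxIdeal {p : CoordRing K} {d : ℤ} (hp : IsHomogeneousOfDegree p d)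
    (hd : 0 < d) : p ∈ irrelevantMaxIdeal K := by
  rcases hp with rfl | ⟨n, rfl, hn⟩
  · exact zero_mem _
  · rw [irrelevantMaxIdeal, ← Set.image_univ, mem_span_X_image_iff_killVars]
    have h0 : coeff 0 p = 0 :=
      hn.coeff_eq_zero (by simpa using fun h0 : 0 = n => hd.ne (by rw [← h0]; rfl))
    have : killVars K Set.univ p = C (constantCoeff p) := by
      simp only [killVars, Set.mem_univ, if_true]
      rw [← MvPolynomial.algebraMap_eq, ← aeval_zero]
      rfl
    rw [this, constantCoeff_eq, h0, map_zero]

end IsHomogeneousOfDegree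

/-- The forms of degree `k ∈ ℤ`, as a subspace; it is zero for `k < 0`. -/
noncomputable def intPiece (K : Type*) [Field K] (k : ℤ) : Submodule K (CoordRing K) :=
  if 0 ≤ k then stdGrading K k.toNat else ⊥

theorem mem_intPiece {k : ℤ} {p : CoordRing K} : p ∈ intPiece K k ↔ IsHomogeneousOfDegree p k := by
  unfold intPiece
  split_ifs with hk
  · constructor
    · exact fun hp => Or.inr ⟨k.toNat, Int.toNat_of_nonneg hk, hp⟩
    · rintro (rfl | ⟨n, rfl, hn⟩)
      · exact zero_mem _
      · simpa using hn
  · constructor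
    · exact fun hp => Or.inl hp
    · rintro (rfl | ⟨n, rfl, hn⟩)
      · exact zero_mem _
      · omega

theorem intPiece_natCast (n : ℕ) : intPiece K n = stdGrading K n := by
  simp [intPiece]

/-- The homogeneous component of degree `k ∈ ℤ`; it is zero for `k < 0`. -/
noncomputable def intComponent (K : Type*) [Field K] (k : ℤ) : CoordRing K →ₗ[K] CoordRing K :=
  if 0 ≤ k then homogeneousComponent k.toNat else 0

theorem intComponent_mem (k : ℤ) (p : CoordRing K) : intComponent K k p ∈ intPiece K k := by
  unfold intComponent intPiece
  split_ifs
  · exact homogeneousComponent_mem _ _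
  · simp

theorem intComponent_of_mem {k : ℤ} {p : CoordRing K} (hp : p ∈ intPiece K k) :
    intComponent K k p = p := by
  unfold intComponent intPiece at *
  split_ifs at *
  · rw [homogeneousComponent_of_mem hp, if_pos rfl]
  · simpa using hp.symm

theorem intComponent_mul {p : CoordRing K} {d : ℤ} (hp : IsHomogeneousOfDegree p d) (k : ℤ)
    (q : CoordRing K) : intComponent K (d + k) (p * q) = p * intComponent K k q := by
  rcases hp with rfl | ⟨n, rfl, hn⟩
  · simp
  have key (m : ℕ) : homogeneousComponent m (p * q) =
      if n ≤ m then p * homogeneousComponent (m - n) q else 0 := by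
    rw [← coeff_homogenizeHom, map_mul, homogenizeHom_of_isHomogeneous hn, mul_assoc,
      Polynomial.coeff_C_mul, mul_comm (Polynomial.X ^ n), Polynomial.coeff_mul_X_pow',
      mul_ite, mul_zero, coeff_homogenizeHom]
  unfold intComponent
  split_ifs with h1 h2 h2
  · rw [key, if_pos (by omega)]
    congr 3
    omega
  · rw [key, if_neg (by omega)]
    simp
  · omega
  · simp

/-! ### Degreewise exactness and the Hilbert function -/

theorem finrank_stdGrading (n : ℕ) : Module.finrank K (stdGrading K n) = (n + 3).choose 3 := by
  have hspan : stdGrading K n = Submodule.span K (Set.range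
      fun d : Finset.finsuppAntidiag (Finset.univ : Finset (Fin 4)) n =>
        (monomial (d : Fin 4 →₀ ℕ) (1 : K))) := by
    apply le_antisymm
    · intro p hp
      rw [p.as_sum]
      refine Submodule.sum_mem _ fun d hd => ?_
      have hdeg : d.degree = n := by
        rw [Finsupp.degree_eq_weight_one]; exact hp (mem_support_iff.1 hd)
      have : monomial d (coeff d p) = coeff d p • monomial d (1 : K) := by
        rw [smul_monomial, smul_eq_mul, mul_one]
      rw [this]
      refine Submodule.smul_mem _ _ (Submodule.subset_span ⟨⟨d, ?_⟩, rfl⟩)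
      rw [Finset.mem_finsuppAntidiag]
      exact ⟨by rw [← hdeg, Finsupp.degree_eq_sum], Finset.subset_univ _⟩
    · rw [Submodule.span_le]
      rintro _ ⟨⟨d, hd⟩, rfl⟩
      rw [Finset.mem_finsuppAntidiag] at hd
      exact isHomogeneous_monomial _ ((Finsupp.degree_eq_sum d).trans hd.1)
  have hli : LinearIndependent K
      fun d : Finset.finsuppAntidiag (Finset.univ : Finset (Fin 4)) n =>
        (monomial (d : Fin 4 →₀ ℕ) (1 : K)) := by
    have := (basisMonomials (Fin 4) K).linearIndependent
    rw [coe_basisMonomials] at this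
    exact this.comp _ Subtype.val_injective
  rw [hspan, finrank_span_eq_card hli, Fintype.card_coe, Finset.card_finsuppAntidiag_nat_eq_choose,
    Finset.card_univ, Fintype.card_fin, show 4 + n - 1 = n + 3 by omega]
  exact Nat.choose_symm_add

instance (k : ℤ) : FiniteDimensional K (intPiece K k) := by
  unfold intPiece
  by_cases hk : 0 ≤ k
  · rw [if_pos ‹_›]
    exact Module.Finite.iff_fg.2 (homogeneousSubmodule_fg (Fin 4) K _)
  · rw [if_neg ‹_›]
    infer_instance

/-- For `k ≥ -3`, the dimension of the space of forms of degree `k` is given by the polynomial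
`(k + 1) (k + 2) (k + 3) / 6`. -/
theorem six_mul_finrank_intPiece {k : ℤ} (hk : -3 ≤ k) :
    6 * (Module.finrank K (intPiece K k) : ℤ) = (k + 1) * (k + 2) * (k + 3) := by
  rcases le_or_gt 0 k with h0 | h0
  · lift k to ℕ using h0
    rw [intPiece_natCast, finrank_stdGrading]
    have := Nat.descFactorial_eq_factorial_mul_choose (k + 3) 3
    simp only [Nat.descFactorial_succ, Nat.descFactorial_zero, Nat.factorial] at this
    rw [show k + 3 - 2 = k + 1 by omega, show k + 3 - 1 = k + 2 by omega] at this
    zify at this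
    simp only [Nat.sub_zero] at this
    push_cast at this
    linarith
  · have : intPiece K k = ⊥ := by simp [intPiece, h0]
    rw [this, finrank_bot]
    obtain rfl | rfl | rfl : k = -3 ∨ k = -2 ∨ k = -1 := by omega
    all_goals norm_num

/-- The piece of degree `k` of `⨁ i, R(-a i)`, as a vector space. -/
noncomputable def freePieceSubmodule (K : Type*) [Field K] {m : ℕ} (a : Fin m → ℤ) (k : ℤ) :
    Submodule K (Fin m → CoordRing K) :=
  Submodule.pi Set.univ fun i => intPiece K (k - a i)

theorem mem_freePieceSubmodule {m : ℕ} {a : Fin m → ℤ} {k : ℤ} {v : Fin m → CoordRing K} :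
    v ∈ freePieceSubmodule K a k ↔ v ∈ freePiece a k := by
  simp [freePieceSubmodule, freePiece, Submodule.mem_pi, mem_intPiece]

/-- A vector space of tuples with entries in given subspaces is their product. -/
noncomputable def freePieceEquiv {m : ℕ} (a : Fin m → ℤ) (k : ℤ) :
    freePieceSubmodule K a k ≃ₗ[K] ∀ i, intPiece K (k - a i) where
  toFun v i := ⟨v.1 i, v.2 i trivial⟩
  invFun w := ⟨fun i => w i, fun i _ => (w i).2⟩
  map_add' _ _ := rfl
  map_smul' _ _ := rfl

instance {m : ℕ} (a : Fin m → ℤ) (k : ℤ) : FiniteDimensional K (freePieceSubmodule K a k) :=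
  Module.Finite.equiv (freePieceEquiv a k).symm

theorem finrank_freePieceSubmodule {m : ℕ} (a : Fin m → ℤ) (k : ℤ) :
    Module.finrank K (freePieceSubmodule K a k) =
      ∑ i, Module.finrank K (intPiece K (k - a i)) := by
  rw [(freePieceEquiv a k).finrank_eq, Module.finrank_pi_fintype]

/-- A matrix preserves degrees if and only if its entries are homogeneous of the expected degrees, as
is seen on the standard basis vectors. -/
theorem isGradedMap_iff {m n : ℕ} {b : Fin n → ℤ} {a : Fin m → ℤ}
    {M : Matrix (Fin m) (Fin n) (CoordRing K)} :
    IsGradedMap b a M ↔ ∀ i j, IsHomogeneousOfDegree (M i j) (b j - a i) := by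
  constructor
  · intro H i j
    have := H (b j) (Pi.single j 1) (fun j' => by
      by_cases h : j' = j
      · subst h
        rw [Pi.single_eq_same]
        exact Or.inr ⟨0, by simp, isHomogeneous_one _ _⟩
      · rw [Pi.single_eq_of_ne h]
        exact Or.inl rfl) i
    rwa [Matrix.mulVec_single_one] at this
  · intro H k v hv i
    exact IsHomogeneousOfDegree.sum Finset.univ fun j _ =>
      ((H i j).mul (hv j)).congr (sub_add_sub_cancel' _ _ _)

/-- A homomorphism of graded modules commutes with taking homogeneous components. -/
theorem mulVec_intComponent {m n : ℕ} {b : Fin n → ℤ} {a : Fin m → ℤ}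
    {M : Matrix (Fin m) (Fin n) (CoordRing K)} (hM : IsGradedMap b a M) (k : ℤ)
    (v : Fin n → CoordRing K) :
    M.mulVec (fun j => intComponent K (k - b j) (v j)) =
      fun i => intComponent K (k - a i) (M.mulVec v i) := by
  ext1 i
  simp only [Matrix.mulVec, dotProduct, map_sum]
  refine Finset.sum_congr rfl fun j _ => ?_
  rw [← intComponent_mul (isGradedMap_iff.1 hM i j)]
  congr 2
  ring

theorem exists_mem_freePiece_of_mulVec_eq {m n : ℕ} {b : Fin n → ℤ} {a : Fin m → ℤ}
    {M : Matrix (Fin m) (Fin n) (CoordRing K)} (hM : IsGradedMap b a M) {k : ℤ}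
    {w : Fin m → CoordRing K} (hw : w ∈ freePiece a k) {v : Fin n → CoordRing K}
    (hv : M.mulVec v = w) : ∃ u ∈ freePiece b k, M.mulVec u = w := by
  refine ⟨fun j => intComponent K (k - b j) (v j),
    fun j => mem_intPiece.1 (intComponent_mem _ _), ?_⟩
  rw [mulVec_intComponent hM, hv]
  ext1 i
  exact intComponent_of_mem (mem_intPiece.2 (hw i))

theorem finrank_map_add_finrank_inf_ker {V W : Type*} [AddCommGroup V] [Module K V]
    [AddCommGroup W] [Module K W] (f : V →ₗ[K] W) (S : Submodule K V) [FiniteDimensional K S] :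
    Module.finrank K (S.map f) + Module.finrank K ↥(S ⊓ LinearMap.ker f) =
      Module.finrank K S := by
  have h := LinearMap.finrank_range_add_finrank_ker (f.domRestrict S)
  rw [LinearMap.range_domRestrict] at h
  rw [← h]
  congr 1
  have : S ⊓ LinearMap.ker f = (LinearMap.ker (f.domRestrict S)).map S.subtype := by
    ext v
    simp [and_comm]
  rw [this]
  exact (Submodule.equivMapOfInjective _ S.injective_subtype _).symm.finrank_eq

/-- The alternating sum of the dimensions of the pieces of degree `n` in a graded free
resolution. -/
theorem IsMinimalGradedFreeResolution.finrank_quotGrading {J : HomogeneousIdeal (stdGrading K)}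
    {n₁ n₂ n₃ : ℕ} {a₁ : Fin n₁ → ℤ} {a₂ : Fin n₂ → ℤ} {a₃ : Fin n₃ → ℤ}
    {φ₁ : Matrix (Fin 1) (Fin n₁) (CoordRing K)} {φ₂ : Matrix (Fin n₁) (Fin n₂) (CoordRing K)}
    {φ₃ : Matrix (Fin n₂) (Fin n₃) (CoordRing K)}
    (H : IsMinimalGradedFreeResolution J.toIdeal a₁ a₂ a₃ φ₁ φ₂ φ₃) (n : ℕ) :
    (Module.finrank K (quotGrading J n) : ℤ) = Module.finrank K (intPiece K n) -
      ∑ i, (Module.finrank K (intPiece K (n - a₁ i)) : ℤ) +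
      ∑ i, (Module.finrank K (intPiece K (n - a₂ i)) : ℤ) -
      ∑ i, (Module.finrank K (intPiece K (n - a₃ i)) : ℤ) := by
  let f₁ := φ₁.mulVecLin.restrictScalars K
  let f₂ := φ₂.mulVecLin.restrictScalars K
  let f₃ := φ₃.mulVecLin.restrictScalars K
  let q := (Ideal.Quotient.mkₐ K J.toIdeal).toLinearMap
  let e : CoordRing K →ₗ[K] (Fin 1 → CoordRing K) := LinearMap.pi fun _ => LinearMap.id
  have he : Function.Injective e := fun p q h => congrFun h 0
  have hq := finrank_map_add_finrank_inf_ker q (intPiece K n)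
  have h1 := finrank_map_add_finrank_inf_ker f₁ (freePieceSubmodule K a₁ n)
  have h2 := finrank_map_add_finrank_inf_ker f₂ (freePieceSubmodule K a₂ n)
  have h3 := finrank_map_add_finrank_inf_ker f₃ (freePieceSubmodule K a₃ n)
  have hmap : (freePieceSubmodule K a₁ n).map f₁ = (intPiece K n ⊓ LinearMap.ker q).map e := by
    ext w
    simp only [Submodule.mem_map, Submodule.mem_inf, mem_freePieceSubmodule]
    constructor
    · rintro ⟨v, hv, rfl⟩
      refine ⟨φ₁.mulVec v 0, ⟨?_, ?_⟩, ?_⟩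
      · simpa [mem_intPiece] using H.graded₁ n v hv 0
      · refine Ideal.Quotient.eq_zero_iff_mem.2 ((H.range₁ _).2 ⟨v, ?_⟩)
        ext1 i
        fin_cases i
        rfl
      · ext1 i
        fin_cases i
        rfl
    · rintro ⟨p, ⟨hp, hpJ⟩, rfl⟩
      obtain ⟨v, hv⟩ := (H.range₁ p).1 (Ideal.Quotient.eq_zero_iff_mem.1 hpJ)
      obtain ⟨u, hu, hu'⟩ := exists_mem_freePiece_of_mulVec_eq H.graded₁ (k := n) (fun i => by
        fin_cases i
        simpa using mem_intPiece.1 hp) hv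
      refine ⟨u, hu, hu'.trans ?_⟩
      ext1 i
      fin_cases i
      rfl
  have hker1 : freePieceSubmodule K a₁ n ⊓ LinearMap.ker f₁ =
      (freePieceSubmodule K a₂ n).map f₂ := by
    ext w
    simp only [Submodule.mem_map, Submodule.mem_inf, mem_freePieceSubmodule]
    constructor
    · rintro ⟨hw, hw0⟩
      obtain ⟨v, hv⟩ := (H.exact₁ w).1 hw0
      exact exists_mem_freePiece_of_mulVec_eq H.graded₂ hw hv
    · rintro ⟨v, hv, rfl⟩
      exact ⟨H.graded₂ n v hv, (H.exact₁ _).2 ⟨v, rfl⟩⟩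
  have hker2 : freePieceSubmodule K a₂ n ⊓ LinearMap.ker f₂ =
      (freePieceSubmodule K a₃ n).map f₃ := by
    ext w
    simp only [Submodule.mem_map, Submodule.mem_inf, mem_freePieceSubmodule]
    constructor
    · rintro ⟨hw, hw0⟩
      obtain ⟨v, hv⟩ := (H.exact₂ w).1 hw0
      exact exists_mem_freePiece_of_mulVec_eq H.graded₃ hw hv
    · rintro ⟨v, hv, rfl⟩
      exact ⟨H.graded₃ n v hv, (H.exact₂ _).2 ⟨v, rfl⟩⟩
  have hker3 : LinearMap.ker f₃ = ⊥ := LinearMap.ker_eq_bot.2 H.injective₃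
  have hfin := (Submodule.equivMapOfInjective e he (intPiece K n ⊓ LinearMap.ker q)).finrank_eq
  have hquot : quotGrading J n = (intPiece K n).map q := by rw [intPiece_natCast]; rfl
  rw [hker1, hmap, ← hfin, finrank_freePieceSubmodule] at h1
  rw [hker2, finrank_freePieceSubmodule] at h2
  rw [hker3, inf_bot_eq, finrank_bot, finrank_freePieceSubmodule] at h3
  rw [hquot]
  push_cast [← Nat.cast_sum]
  omega

end IntDegree

/-! ### The resolution of the ideal of the curve and its Hilbert polynomial -/

section

variable {K : Type*} [Field K] {h F G A B : CoordRing K} {dh : ℤ} {dF dG : ℕ}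

theorem curveIdeal_isHomogeneous (hFdeg : F.IsHomogeneous dF) (hGdeg : G.IsHomogeneous dG)
    (hhdeg : IsHomogeneousOfDegree h dh) (hAdeg : IsHomogeneousOfDegree A (dh + dF - 1))
    (hBdeg : IsHomogeneousOfDegree B (dh + dG - 1)) :
    (curveIdeal (X 0) (X 1) h F G A B).IsHomogeneous (stdGrading K) := by
  have hF := IsHomogeneousOfDegree.of_isHomogeneous hFdeg
  have hG := IsHomogeneousOfDegree.of_isHomogeneous hGdeg
  have h0 := IsHomogeneousOfDegree.X (K := K) 0
  have h1 := IsHomogeneousOfDegree.X (K := K) 1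
  have aux {p : CoordRing K} {d : ℤ} (hp : IsHomogeneousOfDegree p d) :
      SetLike.IsHomogeneousElem (stdGrading K) p := by
    rcases hp with rfl | ⟨n, -, hn⟩
    · exact ⟨0, zero_mem _⟩
    · exact ⟨n, hn⟩
  refine Ideal.homogeneous_span _ _ ?_
  rintro p (rfl | rfl | rfl | rfl)
  · exact aux (h0.mul h1)
  · rw [pow_two]
    exact aux (((h0.mul h0).mul hAdeg).add (((h0.mul hhdeg).mul hF).congr (by ring)))
  · rw [pow_two]
    exact aux (((h1.mul h1).mul hBdeg).add (((h1.mul hhdeg).mul hG).congr (by ring)))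
  · exact aux ((((h0.mul hAdeg).mul hG).add (((h1.mul hBdeg).mul hF).congr (by ring))).add
      (((hhdeg.mul hF).mul hG).congr (by ring)))

theorem curveIdeal_isMinimalGradedFreeResolution
    (D : CurveDatum (X 0) (X 1) h F G A B) (hdF : 0 < dF) (hdG : 0 < dG)
    (hFdeg : F.IsHomogeneous dF) (hGdeg : G.IsHomogeneous dG)
    (hhdeg : IsHomogeneousOfDegree h dh) (hAdeg : IsHomogeneousOfDegree A (dh + dF - 1))
    (hBdeg : IsHomogeneousOfDegree B (dh + dG - 1)) :
    IsMinimalGradedFreeResolution (curveIdeal (X 0) (X 1) h F G A B)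
      ![2, dF + dh + 1, dG + dh + 1, dF + dG + dh]
      ![dF + dh + 2, dG + dh + 2, dF + dG + dh + 1, dF + dG + dh + 1]
      ![dF + dG + dh + 2]
      !![X 0 * X 1, X 0 ^ 2 * A + X 0 * h * F, X 1 ^ 2 * B + X 1 * h * G,
          X 0 * A * G + X 1 * B * F + h * F * G]
      !![X 0 * A + h * F, X 1 * B + h * G, A * G, B * F;
          -X 1, 0, 0, G;
          0, -X 0, F, 0;
          0, 0, -X 1, -X 0]
      !![G; -F; -X 0; X 1] := by
  have hF := IsHomogeneousOfDegree.of_isHomogeneous hFdeg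
  have hG := IsHomogeneousOfDegree.of_isHomogeneous hGdeg
  have h0 := IsHomogeneousOfDegree.X (K := K) 0
  have h1 := IsHomogeneousOfDegree.X (K := K) 1
  have mF := hF.mem_irrelevantMaxIdeal (by exact_mod_cast hdF)
  have mG := hG.mem_irrelevantMaxIdeal (by exact_mod_cast hdG)
  have m0 := h0.mem_irrelevantMaxIdeal one_pos
  have m1 := h1.mem_irrelevantMaxIdeal one_pos
  refine ⟨isGradedMap_iff.2 fun i j => ?_, isGradedMap_iff.2 fun i j => ?_,
    isGradedMap_iff.2 fun i j => ?_, fun p => ?_, fun v => ?_, fun v => ?_, fun v w hvw => ?_,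
    fun i j => ?_, fun i j => ?_⟩
  · fin_cases i; fin_cases j
    · exact (h0.mul h1).congr (by simp)
    · change IsHomogeneousOfDegree (X 0 ^ 2 * A + X 0 * h * F) _
      rw [pow_two]
      exact (((h0.mul h0).mul hAdeg).add (((h0.mul hhdeg).mul hF).congr (by ring))).congr
        (by simp; ring)
    · change IsHomogeneousOfDegree (X 1 ^ 2 * B + X 1 * h * G) _
      rw [pow_two]
      exact (((h1.mul h1).mul hBdeg).add (((h1.mul hhdeg).mul hG).congr (by ring))).congr
        (by simp; ring)
    · exact ((((h0.mul hAdeg).mul hG).add (((h1.mul hBdeg).mul hF).congr (by ring))).add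
        (((hhdeg.mul hF).mul hG).congr (by ring))).congr (by simp; ring)
  · fin_cases i <;> fin_cases j
    · exact ((h0.mul hAdeg).add ((hhdeg.mul hF).congr (by ring))).congr (by simp; ring)
    · exact ((h1.mul hBdeg).add ((hhdeg.mul hG).congr (by ring))).congr (by simp; ring)
    · exact (hAdeg.mul hG).congr (by simp; ring)
    · exact (hBdeg.mul hF).congr (by simp; ring)
    · exact h1.neg.congr (by simp)
    · exact IsHomogeneousOfDegree.zero _
    · exact IsHomogeneousOfDegree.zero _
    · exact hG.congr (by simp)
    · exact IsHomogeneousOfDegree.zero _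
    · exact h0.neg.congr (by simp)
    · exact hF.congr (by simp)
    · exact IsHomogeneousOfDegree.zero _
    · exact IsHomogeneousOfDegree.zero _
    · exact IsHomogeneousOfDegree.zero _
    · exact h1.neg.congr (by simp)
    · exact h0.neg.congr (by simp)
  · fin_cases j; fin_cases i
    · exact hG.congr (by simp)
    · exact hF.neg.congr (by simp)
    · exact h0.neg.congr (by simp)
    · exact h1.congr (by simp)
  · rw [mem_curveIdeal]
    constructor
    · rintro ⟨a, b, c, d, rfl⟩
      refine ⟨![a, b, c, d], ?_⟩
      ext1 i
      fin_cases i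
      simp [Matrix.mulVec, dotProduct, Fin.sum_univ_four]
      ring
    · rintro ⟨v, hv⟩
      refine ⟨v 0, v 1, v 2, v 3, ?_⟩
      have := congrFun hv 0
      simp [Matrix.mulVec, dotProduct, Fin.sum_univ_four] at this
      rw [← this]
      ring
  · constructor
    · intro hv
      have := congrFun hv 0
      simp [Matrix.mulVec, dotProduct, Fin.sum_univ_four] at this
      obtain ⟨u₀, u₁, u₂, u₃, e0, e1, e2, e3⟩ := D.exists_of_syzygy (a := v 0) (b := v 1)
        (c := v 2) (d := v 3) (by linear_combination this)
      refine ⟨![u₀, u₁, u₂, u₃], ?_⟩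
      ext1 i
      fin_cases i <;> simp [Matrix.mulVec, dotProduct, Fin.sum_univ_four, e0, e1, e2, e3]
    · rintro ⟨u, rfl⟩
      ext1 i
      fin_cases i
      simp [Matrix.mulVec, dotProduct, Fin.sum_univ_four]
      ring
  · constructor
    · intro hv
      have hv1 := congrFun hv 1
      have hv2 := congrFun hv 2
      have hv3 := congrFun hv 3
      simp [Matrix.mulVec, dotProduct, Fin.sum_univ_four] at hv1 hv2 hv3
      obtain ⟨w, e0, e1, e2, e3⟩ := D.exists_of_second_syzygy (u₀ := v 0) (u₁ := v 1)
        (u₂ := v 2) (u₃ := v 3) (by linear_combination hv1) (by linear_combination hv2)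
        (by linear_combination hv3)
      refine ⟨![w], ?_⟩
      ext1 i
      fin_cases i <;> simp [Matrix.mulVec, dotProduct, e0, e1, e2, e3]
    · rintro ⟨u, rfl⟩
      ext1 i
      fin_cases i <;> simp [Matrix.mulVec, dotProduct, Fin.sum_univ_four] <;> ring
  · have := congrFun hvw 3
    simp [Matrix.mulVec, dotProduct] at this
    ext1 i
    fin_cases i
    exact this
  · fin_cases i <;> fin_cases j
    · exact add_mem (Ideal.mul_mem_right _ _ m0) (Ideal.mul_mem_left _ _ mF)
    · exact add_mem (Ideal.mul_mem_right _ _ m1) (Ideal.mul_mem_left _ _ mG)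
    · exact Ideal.mul_mem_left _ _ mG
    · exact Ideal.mul_mem_left _ _ mF
    · exact neg_mem m1
    · exact zero_mem _
    · exact zero_mem _
    · exact mG
    · exact zero_mem _
    · exact neg_mem m0
    · exact mF
    · exact zero_mem _
    · exact zero_mem _
    · exact zero_mem _
    · exact neg_mem m1
    · exact neg_mem m0
  · fin_cases j; fin_cases i
    · exact mG
    · exact neg_mem mF
    · exact neg_mem m0
    · exact m1

/-- The degree `2d_h + d_F + d_G` is positive: if `h ≠ 0` then `d_h ≥ 0`, and if `h = 0` then
`deg A, deg B ≥ 0`. -/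
theorem degree_pos (hAB : h = 0 → A * B ≠ 0) (hdF : 0 < dF) (hdG : 0 < dG)
    (hhdeg : IsHomogeneousOfDegree h dh) (hAdeg : IsHomogeneousOfDegree A (dh + dF - 1))
    (hBdeg : IsHomogeneousOfDegree B (dh + dG - 1)) : 0 < 2 * dh + dF + dG := by
  have aux {p : CoordRing K} {d : ℤ} (hp : IsHomogeneousOfDegree p d) (h0 : p ≠ 0) : 0 ≤ d := by
    obtain ⟨n, rfl, -⟩ := hp.resolve_left h0
    omega
  by_cases h0 : h = 0
  · have hA := aux hAdeg (left_ne_zero_of_mul (hAB h0))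
    have hB := aux hBdeg (right_ne_zero_of_mul (hAB h0))
    omega
  · have := aux hhdeg h0
    omega

theorem hasDegree_of_isMinimalGradedFreeResolution {J : HomogeneousIdeal (stdGrading K)}
    {φ₁ : Matrix (Fin 1) (Fin 4) (CoordRing K)} {φ₂ : Matrix (Fin 4) (Fin 4) (CoordRing K)}
    {φ₃ : Matrix (Fin 4) (Fin 1) (CoordRing K)}
    (H : IsMinimalGradedFreeResolution J.toIdeal
      ![2, dF + dh + 1, dG + dh + 1, dF + dG + dh]
      ![dF + dh + 2, dG + dh + 2, dF + dG + dh + 1, dF + dG + dh + 1]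
      ![dF + dG + dh + 2] φ₁ φ₂ φ₃) (hpos : 0 < 2 * dh + dF + dG) :
    HasDegree J 1 (2 * dh + dF + dG) := by
  set e : ℚ := (2 * dh + dF + dG) / 2 + (dF + dG + dh) - ((dF + dh) ^ 2 + (dG + dh) ^ 2) / 2 with he
  have hd : ((2 * dh + dF + dG : ℤ) : ℚ) ≠ 0 := by exact_mod_cast hpos.ne'
  refine ⟨Polynomial.C ((2 * dh + dF + dG : ℤ) : ℚ) * Polynomial.X + Polynomial.C e, ?_, ?_,
    Polynomial.natDegree_linear hd, ?_⟩
  · -- from this degree on, the dimensions in the resolution are given by polynomials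
    filter_upwards [Filter.eventually_ge_atTop (2 + 2 * dF + 2 * dG + dh.toNat)] with n hn
    obtain ⟨r, hr⟩ : ∃ r : ℤ → ℕ, ∀ k, Module.finrank K (intPiece K k) = r k := ⟨_, fun _ => rfl⟩
    have hrank := H.finrank_quotGrading n
    simp only [hr] at hrank
    have c {a : ℤ} (ha : a ≤ n) : 6 * (r (n - a) : ℤ) =
        (n - a + 1) * (n - a + 2) * (n - a + 3) := by
      rw [← hr]; exact six_mul_finrank_intPiece (by omega)
    have c0 : 6 * (r n : ℤ) = (n + 1) * (n + 2) * (n + 3) := by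
      rw [← hr]; exact six_mul_finrank_intPiece (by omega)
    have c1 := c (a := 2) (by omega)
    have c2 := c (a := dF + dh + 1) (by omega)
    have c3 := c (a := dG + dh + 1) (by omega)
    have c4 := c (a := dF + dG + dh) (by omega)
    have c5 := c (a := dF + dh + 2) (by omega)
    have c6 := c (a := dG + dh + 2) (by omega)
    have c7 := c (a := dF + dG + dh + 1) (by omega)
    have c8 := c (a := dF + dG + dh + 2) (by omega)
    simp only [Fin.sum_univ_four, Fin.sum_univ_one, Matrix.cons_val] at hrank
    rw [← @Int.cast_inj ℚ] at hrank c0 c1 c2 c3 c4 c5 c6 c7 c8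
    push_cast at hrank c0 c1 c2 c3 c4 c5 c6 c7 c8
    simp only [Polynomial.eval_add, Polynomial.eval_mul, Polynomial.eval_C, Polynomial.eval_X, he]
    push_cast
    linear_combination hrank + (c0 - c1 - c2 - c3 - c4 + c5 + c6 + 2 * c7 - c8) / 6
  · intro h0
    have := Polynomial.natDegree_linear (b := e) hd
    rw [h0, Polynomial.natDegree_zero] at this
    exact zero_ne_one this
  · rw [Polynomial.leadingCoeff_linear hd]
    simp

end

/-! ### Heights of homogeneous primes -/

section Heights

variable {K : Type*} [Field K]

theorem irrelevantMaxIdeal_eq : irrelevantMaxIdeal K = Ideal.span (X '' Set.univ) := by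
  rw [irrelevantMaxIdeal, Set.image_univ]

instance irrelevantMaxIdeal_isPrime : (irrelevantMaxIdeal K).IsPrime := by
  rw [irrelevantMaxIdeal_eq]
  exact isPrime_span_X_image K _

theorem height_le_four {p : Ideal (CoordRing K)} (hp : p.IsPrime) : p.height ≤ 4 := by
  have h1 := Ideal.height_le_ringKrullDim_of_isPrime (I := p)
  rw [MvPolynomial.ringKrullDim_of_isNoetherianRing, ringKrullDim_eq_zero_of_field] at h1
  simp only [Nat.card_eq_fintype_card, Fintype.card_fin, zero_add] at h1
  exact WithBot.coe_le_coe.1 h1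

theorem height_add_one_le_of_lt {p q : Ideal (CoordRing K)} (hp : p.IsPrime) (hq : q.IsPrime)
    (h : p < q) : p.height + 1 ≤ q.height := Ideal.height_add_one_le_of_lt_of_isPrime h

theorem add_one_le_height {p q : Ideal (CoordRing K)} (hp : p.IsPrime) (hq : q.IsPrime)
    (h : p ≤ q) {a : CoordRing K} (haq : a ∈ q) (hap : a ∉ p) {n : ℕ∞} (hn : n ≤ p.height) :
    n + 1 ≤ q.height :=
  (add_le_add_left hn 1).trans (height_add_one_le_of_lt hp hq (lt_of_le_of_ne h
    (by rintro rfl; exact hap haq)))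

/-- A prime ideal containing the variables in `s` has height at least the number of those
variables. -/
theorem card_le_height_span_X_image (s : Finset (Fin 4)) :
    (s.card : ℕ∞) ≤ (Ideal.span (X '' (s : Set (Fin 4)) : Set (CoordRing K))).height := by
  induction s using Finset.induction_on with
  | empty => simp
  | insert i s hi ih =>
    rw [Finset.card_insert_of_notMem hi]
    push_cast
    refine add_one_le_height (a := X i) (isPrime_span_X_image K _) (isPrime_span_X_image K _)
      (Ideal.span_mono (Set.image_mono (Set.subset_insert _ _)))
      (Ideal.subset_span ⟨i, by simp, rfl⟩) ?_ ih
    rw [mem_span_X_image_iff_killVars, killVars_X_of_notMem (by simpa using hi)]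
    exact X_ne_zero i

theorem height_irrelevantMaxIdeal : (irrelevantMaxIdeal K).height = 4 := by
  refine le_antisymm (height_le_four irrelevantMaxIdeal_isPrime) ?_
  have := card_le_height_span_X_image (K := K) Finset.univ
  rw [Finset.coe_univ, ← irrelevantMaxIdeal_eq] at this
  simpa using this

/-- A proper homogeneous ideal is contained in `(x, y, z, t)`. -/
theorem le_irrelevantMaxIdeal {p : Ideal (CoordRing K)} (hp : p.IsHomogeneous (stdGrading K))
    (hne : p ≠ ⊤) : p ≤ irrelevantMaxIdeal K := by
  intro a ha
  rw [← sum_homogeneousComponent a]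
  refine Ideal.sum_mem _ fun n _ => ?_
  rcases Nat.eq_zero_or_pos n with rfl | hn
  · have h0 := homogeneousComponent_mem_of_mem hp ha 0
    rw [homogeneousComponent_zero] at h0 ⊢
    by_cases hc : coeff 0 a = 0
    · rw [hc, map_zero]; exact zero_mem _
    · exact absurd (Ideal.eq_top_of_isUnit_mem _ h0 ((isUnit_iff_ne_zero.2 hc).map C)) hne
  · exact (IsHomogeneousOfDegree.of_isHomogeneous
      (homogeneousComponent_isHomogeneous n a)).mem_irrelevantMaxIdeal (by exact_mod_cast hn)

/-- A homogeneous prime generated by two forms is not the ideal of a closed point: adding a variable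
outside of it gives an ideal with three generators, over which, by Krull's height theorem, the
ideal `(x, y, z, t)` of height four is not minimal. -/
theorem exists_lt_of_span_pair {a b : CoordRing K} (hP : (Ideal.span {a, b}).IsPrime)
    (ha : SetLike.IsHomogeneousElem (stdGrading K) a)
    (hb : SetLike.IsHomogeneousElem (stdGrading K) b) :
    ∃ q : Ideal (CoordRing K), q.IsPrime ∧ q.IsHomogeneous (stdGrading K) ∧
      Ideal.span {a, b} < q ∧ ¬ irrelevantMaxIdeal K ≤ q := by
  have hle2 : (Ideal.span {a, b}).height ≤ 2 := by
    refine (Ideal.height_le_card_of_mem_minimalPrimes_span (s := {a, b}) (Set.toFinite _)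
      (by rw [Ideal.minimalPrimes_eq_subsingleton_self]; rfl)).trans ?_
    have := Set.ncard_insert_le a {b}
    rw [Set.ncard_singleton] at this
    exact_mod_cast this
  obtain ⟨i, hi⟩ : ∃ i, X i ∉ Ideal.span {a, b} := by
    by_contra! hall
    have hle : irrelevantMaxIdeal K ≤ Ideal.span {a, b} := by
      rw [irrelevantMaxIdeal, Ideal.span_le]
      rintro _ ⟨i, rfl⟩
      exact hall i
    have := (Ideal.height_mono hle).trans hle2
    rw [height_irrelevantMaxIdeal] at this
    exact absurd this (by decide)
  have hIhom : (Ideal.span {X i, a, b}).IsHomogeneous (stdGrading K) := by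
    refine Ideal.homogeneous_span _ _ ?_
    rintro _ (rfl | rfl | rfl)
    · exact ⟨1, isHomogeneous_X K i⟩
    · exact ha
    · exact hb
  by_contra! hcon
  have hrad : irrelevantMaxIdeal K ≤ (Ideal.span {X i, a, b}).radical := by
    rw [hIhom.radical_eq]
    refine le_sInf fun q hq => hcon q hq.2.2 hq.1 (lt_of_le_of_ne ?_ ?_)
    · exact (Ideal.span_mono (Set.subset_insert _ _)).trans hq.2.1
    · rintro rfl
      exact hi (hq.2.1 (Ideal.subset_span (by simp)))
  have hle : Ideal.span {X i, a, b} ≤ irrelevantMaxIdeal K := by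
    rw [Ideal.span_insert, sup_le_iff]
    refine ⟨(Ideal.span_singleton_le_iff_mem _).2 (Ideal.subset_span ⟨i, rfl⟩),
      le_irrelevantMaxIdeal (Ideal.homogeneous_span _ _ ?_) hP.ne_top⟩
    rintro _ (rfl | rfl)
    · exact ha
    · exact hb
  have hmin : irrelevantMaxIdeal K ∈ (Ideal.span {X i, a, b}).minimalPrimes :=
    ⟨⟨irrelevantMaxIdeal_isPrime, hle⟩, fun q hq _ => hrad.trans (hq.1.radical_le_iff.2 hq.2)⟩
  have h3 := Ideal.height_le_card_of_mem_minimalPrimes_span (Set.toFinite _) hmin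
  rw [height_irrelevantMaxIdeal] at h3
  have h4 : Set.ncard {X i, a, b} ≤ 3 := by
    have h6 := Set.ncard_insert_le (X i) {a, b}
    have h7 := Set.ncard_insert_le a {b}
    rw [Set.ncard_singleton] at h7
    omega
  have h5 : (4 : ℕ∞) ≤ ((3 : ℕ) : ℕ∞) := h3.trans (by exact_mod_cast h4)
  exact absurd h5 (by decide)

/-- There is no chain of four primes of height at least two that ends in `(x, y, z, t)`. -/
theorem not_chain_of_two_le_height {p₀ p₁ p₂ : Ideal (CoordRing K)} (h₀ : p₀.IsPrime)
    (h₁ : p₁.IsPrime) (h₂ : p₂.IsPrime) (hht : 2 ≤ p₀.height) (h01 : p₀ < p₁) (h12 : p₁ < p₂)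
    (h : p₂ < irrelevantMaxIdeal K) : False := by
  have e1 := height_add_one_le_of_lt h₀ h₁ h01
  have e2 := height_add_one_le_of_lt h₁ h₂ h12
  have e3 := height_add_one_le_of_lt h₂ irrelevantMaxIdeal_isPrime h
  rw [height_irrelevantMaxIdeal] at e3
  have : (2 + 1 + 1 + 1 : ℕ∞) ≤ 4 :=
    (add_le_add_left ((add_le_add_left ((add_le_add_left hht 1).trans e1) 1).trans e2) 1).trans e3
  exact absurd this (by decide)

theorem two_le_height_of_mem {p : Ideal (CoordRing K)} (hp : p.IsPrime) {i : Fin 4}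
    (hi : X i ∈ p) {a : CoordRing K} (ha : a ∈ p) (hia : ¬ X i ∣ a) : 2 ≤ p.height := by
  have h1 : 1 ≤ (Ideal.span {(X i : CoordRing K)}).height := by
    simpa using card_le_height_span_X_image (K := K) {i}
  have hprime := isPrime_span_X_image K {i}
  rw [Set.image_singleton] at hprime
  exact add_one_le_height hprime hp ((Ideal.span_singleton_le_iff_mem _).2 hi) ha
    (by rwa [Ideal.mem_span_singleton]) h1

/-- A point of the curve lies on `x = 0` or `y = 0`, and there on a second surface. -/
theorem two_le_height_of_curveIdeal_le {h F G A B : CoordRing K}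
    (D : CurveDatum (X 0) (X 1) h F G A B)
    {p : Ideal (CoordRing K)} (hp : p.IsPrime) (hJ : curveIdeal (X 0) (X 1) h F G A B ≤ p) :
    2 ≤ p.height := by
  have aux {i j : Fin 4} {h F G A B : CoordRing K} (D : CurveDatum (X i) (X j) h F G A B)
      (hJ : curveIdeal (X i) (X j) h F G A B ≤ p) (hi : X i ∈ p) : 2 ≤ p.height := by
    have h1 : X j * (X j * B + h * G) ∈ p := hJ (mem_curveIdeal.2 ⟨0, 0, 1, 0, by ring⟩)
    have hnu : ¬ (X i : CoordRing K) ∣ 1 := fun hd => X_prime.not_isUnit (isUnit_of_dvd_one hd)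
    rcases hp.mem_or_mem h1 with h2 | h2
    · exact two_le_height_of_mem hp hi h2 fun hd => hnu (D.dvd_of_dvd_y_mul 1 (by rwa [mul_one]))
    · exact two_le_height_of_mem hp hi h2 fun hd => hnu (D.dvd_of_dvd_g_mul 1 (by rwa [mul_one]))
  have h0 : X 0 * X 1 ∈ curveIdeal (X 0) (X 1) h F G A B :=
    mem_curveIdeal.2 ⟨1, 0, 0, 0, by ring⟩
  rcases hp.mem_or_mem (hJ h0) with h1 | h1
  · exact aux D hJ h1
  · exact aux D.swap (by rwa [curveIdeal_swap]) h1

/-- `(x, y, q)` has height at least three for a form `q` in `z, t`. -/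
theorem three_le_height {q : CoordRing K} (hq : killVars K {0, 1} q = q) (hprime : Prime q) :
    3 ≤ (Ideal.span (X '' {0, 1}) ⊔ Ideal.span {q}).height := by
  have h2 : 2 ≤ (Ideal.span (X '' {0, 1} : Set (CoordRing K))).height := by
    simpa using card_le_height_span_X_image (K := K) {0, 1}
  refine add_one_le_height (isPrime_span_X_image K _) (isPrime_span_X_image_sup hq hprime)
    le_sup_left (a := q) (Submodule.mem_sup_right (Ideal.mem_span_singleton_self q)) ?_ h2
  rw [mem_span_X_image_iff_killVars, hq]
  exact hprime.ne_zero

/-- If `F` and `G` are relatively prime forms in `z, t`, then `x = y = F = G = 0` has no point in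
`ℙ³`. -/
theorem irrelevantMaxIdeal_le_of_isRelPrime {F G : CoordRing K}
    (hF : F ∈ supported K ({2, 3} : Set (Fin 4))) (hG : G ∈ supported K ({2, 3} : Set (Fin 4)))
    (hF0 : F ≠ 0) (hrel : IsRelPrime F G) {p : Ideal (CoordRing K)} (hp : p.IsPrime)
    (hpm : p ≤ irrelevantMaxIdeal K) (h0 : X 0 ∈ p) (h1 : X 1 ∈ p) (hFp : F ∈ p) (hGp : G ∈ p) :
    irrelevantMaxIdeal K ≤ p := by
  obtain ⟨q, hqF, hqp⟩ : ∃ q ∈ UniqueFactorizationMonoid.factors F, q ∈ p := by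
    rw [← Ideal.IsPrime.multiset_prod_mem_iff_exists_mem hp]
    exact p.mem_of_dvd (UniqueFactorizationMonoid.factors_prod hF0).symm.dvd hFp
  have hq := UniqueFactorizationMonoid.prime_of_factor q hqF
  have hqdvd := UniqueFactorizationMonoid.dvd_of_mem_factors hqF
  have hkill : killVars K {0, 1} q = q := killVars_eq_of_dvd hF0
    (supported_mono (by intro i; fin_cases i <;> simp) hF) hqdvd
  have h3 := three_le_height hkill hq
  have hle : Ideal.span (X '' {0, 1}) ⊔ Ideal.span {q} ≤ p := by
    rw [sup_le_iff, Ideal.span_le, Ideal.span_singleton_le_iff_mem, Set.image_pair]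
    refine ⟨?_, hqp⟩
    rintro _ (rfl | rfl)
    · exact h0
    · exact h1
  have h4 : 3 + 1 ≤ p.height := by
    refine add_one_le_height (isPrime_span_X_image_sup hkill hq) hp hle hGp (fun hmem => ?_) h3
    rw [mem_span_X_image_sup_iff hkill, killVars_of_mem_supported (by simp) hG] at hmem
    exact hq.not_isUnit (hrel hqdvd hmem)
  by_contra hcon
  have h5 := height_add_one_le_of_lt hp irrelevantMaxIdeal_isPrime (lt_of_le_not_ge hpm hcon)
  rw [height_irrelevantMaxIdeal] at h5
  exact absurd ((add_le_add_left h4 1).trans h5) (by decide)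

/-! ### Forms avoiding finitely many primes -/

/-- Homogeneous prime avoidance over an infinite field: forms in `p` outside the single primes are
brought to a common degree, and a vector space is not a finite union of proper subspaces. -/
theorem exists_form_avoiding [Infinite K] {p : Ideal (CoordRing K)}
    (hp : p.IsHomogeneous (stdGrading K)) (S : Finset (Ideal (CoordRing K)))
    (hprime : ∀ Q ∈ S, Q.IsPrime) (hirr : ∀ Q ∈ S, ¬ irrelevantMaxIdeal K ≤ Q)
    (hle : ∀ Q ∈ S, ¬ p ≤ Q) : ∃ n, ∃ l ∈ p, l.IsHomogeneous n ∧ ∀ Q ∈ S, l ∉ Q := by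
  classical
  have h1 : ∀ Q : S, ∃ d, ∃ a ∈ p, a.IsHomogeneous d ∧ a ∉ (Q : Ideal (CoordRing K)) := by
    intro Q
    obtain ⟨a, ha, haQ⟩ := SetLike.not_le_iff_exists.1 (hle Q Q.2)
    by_contra! hcon
    refine haQ ?_
    rw [← sum_homogeneousComponent a]
    exact Ideal.sum_mem _ fun n _ => hcon n _ (homogeneousComponent_mem_of_mem hp ha n)
      (homogeneousComponent_isHomogeneous n a)
  have h2 : ∀ Q : S, ∃ i : Fin 4, X i ∉ (Q : Ideal (CoordRing K)) := by
    intro Q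
    by_contra! hcon
    refine hirr Q Q.2 ?_
    rw [irrelevantMaxIdeal, Ideal.span_le]
    rintro _ ⟨i, rfl⟩
    exact hcon i
  choose d a hap hahom haQ using h1
  choose i hi using h2
  let N := Finset.univ.sup d
  let E : Submodule K (CoordRing K) := p.restrictScalars K ⊓ stdGrading K N
  let T : Finset (Subspace K E) :=
    S.attach.image fun Q : S => ((Q : Ideal (CoordRing K)).restrictScalars K).comap E.subtype
  have hT : ⊤ ∉ T := by
    intro hmem
    obtain ⟨Q, -, hQ⟩ := Finset.mem_image.1 hmem
    have hb : a Q * X (i Q) ^ (N - d Q) ∈ E := by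
      refine ⟨Ideal.mul_mem_right _ _ (hap Q), ?_⟩
      have := (hahom Q).mul ((isHomogeneous_X K (i Q)).pow (N - d Q))
      rwa [one_mul, Nat.add_sub_cancel' (Finset.le_sup (Finset.mem_univ Q))] at this
    have hmem : (⟨_, hb⟩ : E) ∈ (⊤ : Subspace K E) := trivial
    rw [← hQ] at hmem
    rcases (hprime Q Q.2).mem_or_mem (show a Q * X (i Q) ^ (N - d Q) ∈ (Q : Ideal _) from hmem)
      with h | h
    · exact haQ Q h
    · exact hi Q ((hprime Q Q.2).mem_of_pow_mem _ h)
  have hne := Subspace.biUnion_ne_univ_of_top_notMem hT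
  obtain ⟨l, hl⟩ := (Set.ne_univ_iff_exists_notMem _).1 hne
  refine ⟨N, l, l.2.1, l.2.2, fun Q hQ hlQ => hl ?_⟩
  simp only [Set.mem_iUnion]
  exact ⟨_, Finset.mem_image.2 ⟨⟨Q, hQ⟩, Finset.mem_attach _ _, rfl⟩, hlQ⟩

/-- On the plane curve `Xᵢ = f = 0` a form vanishing on none of the components is a
nonzerodivisor. -/
theorem mem_of_mul_mem_of_avoiding {i : Fin 4} {f l : CoordRing K} (hf : f ∈ supported K {i}ᶜ)
    (hf0 : f ≠ 0)
    (hl : ∀ q ∈ UniqueFactorizationMonoid.factors f, l ∉ Ideal.span (X '' {i}) ⊔ Ideal.span {q})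
    {a : CoordRing K} (ha : l * a ∈ Ideal.span {X i, f}) : a ∈ Ideal.span {X i, f} := by
  have hfk := killVars_of_mem_supported_compl hf
  have key (b : CoordRing K) : b ∈ Ideal.span {X i, f} ↔ f ∣ killVars K {i} b := by
    rw [← mem_span_X_image_sup_iff hfk, Set.image_singleton, ← Ideal.span_insert]
  rw [key] at ha ⊢
  rw [map_mul] at ha
  have hrel : IsRelPrime f (killVars K {i} l) := by
    intro d hdf hdl
    by_contra hd
    obtain ⟨q, hq, hqd⟩ := WfDvdMonoid.exists_irreducible_factor hd (ne_zero_of_dvd_ne_zero hf0 hdf)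
    obtain ⟨r, hr, hqr⟩ := UniqueFactorizationMonoid.exists_mem_factors_of_dvd hf0 hq
      (hqd.trans hdf)
    refine hl r hr ((mem_span_X_image_sup_iff (killVars_eq_of_dvd hf0 hf
      (UniqueFactorizationMonoid.dvd_of_mem_factors hr))).2 ?_)
    exact hqr.symm.dvd.trans (hqd.trans hdl)
  exact hrel.dvd_of_dvd_mul_left ha

end Heights

/-! ### Dimension and depth on one-dimensional schemes -/

section Topology

variable {X : Type*} [TopologicalSpace X]

theorem topologicalKrullDim_le_one_of_specializes [QuasiSober X]
    (H : ∀ x y z : X, x ⤳ y → y ⤳ z → x = y ∨ y = z) : topologicalKrullDim X ≤ 1 := by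
  rw [topologicalKrullDim, Order.krullDim_le_one_iff]
  intro Z
  by_contra! hcon
  obtain ⟨Z₁, hZ₁⟩ := not_isMin_iff.1 hcon.1
  obtain ⟨Z₂, hZ₂⟩ := not_isMax_iff.1 hcon.2
  have gen (S : TopologicalSpace.IrreducibleCloseds X) :
      closure {S.isIrreducible.genericPoint} = (S : Set X) :=
    S.isIrreducible.closure_genericPoint S.isClosed
  have spec {S T : TopologicalSpace.IrreducibleCloseds X} (h : S < T) :
      T.isIrreducible.genericPoint ⤳ S.isIrreducible.genericPoint := by
    rw [specializes_iff_closure_subset, gen, gen]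
    exact h.le
  have ne {S T : TopologicalSpace.IrreducibleCloseds X} (h : S < T) :
      T.isIrreducible.genericPoint ≠ S.isIrreducible.genericPoint := by
    intro he
    refine h.ne (TopologicalSpace.IrreducibleCloseds.ext ?_)
    rw [← gen S, ← gen T, he]
  rcases H _ _ _ (spec hZ₂) (spec hZ₁) with h | h
  · exact ne hZ₂ h
  · exact ne hZ₁ h

theorem one_le_topologicalKrullDim_of_specializes [T0Space X] {x y : X} (h : x ⤳ y)
    (hne : x ≠ y) : 1 ≤ topologicalKrullDim X := by
  rw [topologicalKrullDim, Order.one_le_krullDim_iff]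
  refine ⟨⟨closure {y}, isIrreducible_singleton.closure, isClosed_closure⟩,
    ⟨closure {x}, isIrreducible_singleton.closure, isClosed_closure⟩, lt_of_le_of_ne ?_ ?_⟩
  · exact specializes_iff_closure_subset.1 h
  · intro he
    have he' : closure {y} = closure {x} := congrArg TopologicalSpace.IrreducibleCloseds.carrier he
    exact hne ((specializes_iff_closure_subset.2 he'.le).antisymm
      (specializes_iff_closure_subset.2 he'.ge)).eq

end Topology

section LocalRing

variable {O : Type*} [CommRing O] [IsLocalRing O]

theorem isCohenMacaulayLocal_of_ringKrullDim_eq_zero (h : ringKrullDim O = 0) :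
    IsCohenMacaulayLocal O :=
  ⟨[], RingTheory.Sequence.IsRegular.nil O O, by simp [h]⟩

theorem one_le_ringKrullDim_of_mem_nonZeroDivisors {u : O} (hu : u ∈ IsLocalRing.maximalIdeal O)
    (hu' : u ∈ nonZeroDivisors O) : 1 ≤ ringKrullDim O := by
  have : Nontrivial (O ⧸ Ideal.span {u}) := Ideal.Quotient.nontrivial_iff.2 fun h => by
    rw [Ideal.span_singleton_eq_top] at h
    exact (IsLocalRing.mem_maximalIdeal u).1 hu h
  have h1 := ringKrullDim_nonneg_of_nontrivial (R := O ⧸ Ideal.span {u})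
  calc (1 : WithBot ℕ∞) = 0 + 1 := (zero_add 1).symm
    _ ≤ ringKrullDim (O ⧸ Ideal.span {u}) + 1 := by gcongr
    _ ≤ _ := ringKrullDim_quotient_succ_le_of_nonZeroDivisor hu'

theorem isCohenMacaulayLocal_of_ringKrullDim_le_one (h : ringKrullDim O ≤ 1) {u : O}
    (hu : u ∈ IsLocalRing.maximalIdeal O) (hu' : u ∈ nonZeroDivisors O) :
    IsCohenMacaulayLocal O := by
  refine ⟨[u], ⟨?_, ?_⟩, ?_⟩
  · rw [RingTheory.Sequence.isWeaklyRegular_singleton_iff, isSMulRegular_iff_right_eq_zero_of_smul]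
    intro a ha
    exact (mem_nonZeroDivisors_iff.1 hu').1 a ha
  · intro htop
    have h1 : (1 : O) ∈ (⊤ : Submodule O O) := trivial
    rw [htop, Ideal.ofList_singleton, smul_eq_mul, Ideal.mul_top] at h1
    exact (IsLocalRing.mem_maximalIdeal u).1 hu
      (isUnit_of_dvd_one (Ideal.mem_span_singleton.1 h1))
  · rw [le_antisymm h (one_le_ringKrullDim_of_mem_nonZeroDivisors hu hu')]
    simp

/-- A Cohen-Macaulay local ring in which a nonzero element is killed by the maximal ideal has
dimension zero, because its depth is zero. -/
theorem ringKrullDim_eq_zero_of_socle (h : IsCohenMacaulayLocal O) {s : O} (hs : s ≠ 0)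
    (hs' : ∀ u ∈ IsLocalRing.maximalIdeal O, u * s = 0) : ringKrullDim O = 0 := by
  obtain ⟨rs, hrs, hdim⟩ := h
  cases rs with
  | nil => simpa using hdim.symm
  | cons u rs =>
    exfalso
    have hreg := ((RingTheory.Sequence.isRegular_cons_iff O u rs).1 hrs).1
    have hu : u ∈ IsLocalRing.maximalIdeal O := by
      rw [IsLocalRing.mem_maximalIdeal]
      intro hunit
      refine hrs.top_ne_smul ?_
      have : Ideal.ofList (u :: rs) = ⊤ := Ideal.eq_top_of_isUnit_mem _
        (Ideal.subset_span (by simp)) hunit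
      rw [this, smul_eq_mul, Ideal.mul_top]
    exact hs (hreg (by simpa using hs' u hu))

end LocalRing

section Scheme

variable {X : Scheme}

/-- The points of the spectrum of the local ring at `x` are the generizations of `x`. -/
theorem ringKrullDim_stalk_eq_zero_iff {x : X} :
    ringKrullDim (X.presheaf.stalk x) = 0 ↔ ∀ y, y ⤳ x → y = x := by
  have hinj := (X.fromSpecStalk x).isEmbedding.injective
  constructor
  · intro h y hy
    rw [← ringKrullDimZero_iff_ringKrullDim_eq_zero] at h
    have hx : x ∈ Set.range (X.fromSpecStalk x) := by
      rw [Scheme.range_fromSpecStalk]; exact specializes_rfl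
    have hy : y ∈ Set.range (X.fromSpecStalk x) := by
      rw [Scheme.range_fromSpecStalk]; exact hy
    obtain ⟨a, rfl⟩ := hy
    obtain ⟨b, hb⟩ := hx
    have hsub : Subsingleton (PrimeSpectrum (X.presheaf.stalk x)) :=
      Ring.KrullDimLE.subsingleton_primeSpectrum _
    exact (congrArg _ (hsub.elim a b)).trans hb
  · intro h
    have hsub : Subsingleton (PrimeSpectrum (X.presheaf.stalk x)) := by
      refine ⟨fun a b => hinj ?_⟩
      have aux (a : PrimeSpectrum (X.presheaf.stalk x)) : X.fromSpecStalk x a = x := by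
        refine h _ ?_
        have : X.fromSpecStalk x a ∈ Set.range (X.fromSpecStalk x) := ⟨a, rfl⟩
        rwa [Scheme.range_fromSpecStalk] at this
      exact (aux a).trans (aux b).symm
    exact Order.krullDim_eq_zero

theorem ringKrullDim_stalk_le (x : X) :
    ringKrullDim (X.presheaf.stalk x) ≤ topologicalKrullDim X := by
  rw [← PrimeSpectrum.topologicalKrullDim_eq_ringKrullDim]
  exact (X.fromSpecStalk x).isEmbedding.isInducing.topologicalKrullDim_le

/-- A scheme of dimension at most one is a locally Cohen-Macaulay curve if the local ring at every
closed point has positive depth. -/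
theorem isLocallyCMCurve_of_exists_nonZeroDivisor [hX : Nonempty X]
    (H : ∀ x y z : X, x ⤳ y → y ⤳ z → x = y ∨ y = z)
    (hdepth : ∀ x : X, (∀ y, x ⤳ y → x = y) →
      ∃ u ∈ IsLocalRing.maximalIdeal (X.presheaf.stalk x),
        u ∈ nonZeroDivisors (X.presheaf.stalk x)) : IsLocallyCMCurve X where
  nonempty := hX
  pure_one_dimensional Z hZ := by
    have hle := topologicalKrullDim_le_one_of_specializes H
    refine le_antisymm ((topologicalKrullDim_subspace_le X Z).trans hle) ?_
    have hirr : IsIrreducible Z := hZ.1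
    have hcl : IsClosed Z := isClosed_of_mem_irreducibleComponents Z hZ
    set η := hirr.genericPoint with hη
    have hηZ : closure {η} = Z := hirr.closure_genericPoint hcl
    -- a generic point has no proper generization, so its local ring has dimension zero
    have hdim : ringKrullDim (X.presheaf.stalk η) = 0 := by
      rw [ringKrullDim_stalk_eq_zero_iff]
      intro y hy
      have hsub : Z ⊆ closure {y} := by
        rw [← hηZ]; exact specializes_iff_closure_subset.1 hy
      have := hZ.2 isIrreducible_singleton.closure hsub
      exact (hy.antisymm (specializes_iff_closure_subset.2 (this.trans hηZ.ge))).eq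
    obtain ⟨y, hy, hne⟩ : ∃ y, η ⤳ y ∧ η ≠ y := by
      by_contra! hcon
      obtain ⟨u, hu, hu'⟩ := hdepth η hcon
      have := one_le_ringKrullDim_of_mem_nonZeroDivisors hu hu'
      rw [hdim] at this
      exact absurd this (by decide)
    have hηmem : η ∈ Z := hηZ ▸ subset_closure rfl
    have hymem : y ∈ Z := hηZ ▸ specializes_iff_mem_closure.1 hy
    exact one_le_topologicalKrullDim_of_specializes (x := (⟨η, hηmem⟩ : Z)) (y := ⟨y, hymem⟩)
      (Topology.IsInducing.subtypeVal.specializes_iff.1 hy) fun h => hne (congrArg Subtype.val h)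
  locally_cohenMacaulay x := by
    by_cases hx : ∀ y, x ⤳ y → x = y
    · obtain ⟨u, hu, hu'⟩ := hdepth x hx
      exact isCohenMacaulayLocal_of_ringKrullDim_le_one ((ringKrullDim_stalk_le x).trans
        (topologicalKrullDim_le_one_of_specializes H)) hu hu'
    · push Not at hx
      obtain ⟨y, hy, hne⟩ := hx
      exact isCohenMacaulayLocal_of_ringKrullDim_eq_zero (ringKrullDim_stalk_eq_zero_iff.2
        fun w hw => (H w x y hw hy).resolve_right hne)

/-- On a locally Cohen-Macaulay curve no local ring at a closed point has depth zero: such a point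
would be an irreducible component of dimension zero. -/
theorem IsLocallyCMCurve.not_socle (hX : IsLocallyCMCurve X) {x : X} (hx : ∀ y, x ⤳ y → x = y)
    {s : X.presheaf.stalk x} (hs : s ≠ 0) :
    ¬ ∀ u ∈ IsLocalRing.maximalIdeal (X.presheaf.stalk x), u * s = 0 := by
  intro hsoc
  have hdim := ringKrullDim_eq_zero_of_socle (hX.locally_cohenMacaulay x) hs hsoc
  rw [ringKrullDim_stalk_eq_zero_iff] at hdim
  have hcl : closure {x} = {x} := by
    refine Set.Subset.antisymm (fun y hy => ?_) subset_closure
    exact (hx y (specializes_iff_mem_closure.2 hy)).symm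
  have hcomp : {x} ∈ irreducibleComponents X := by
    refine ⟨isIrreducible_singleton, fun S hS hle y hy => ?_⟩
    have hgen := hS.isGenericPoint_genericPoint_closure
    have h1 : hS.genericPoint ⤳ x := hgen.specializes (subset_closure (hle rfl))
    have h2 : hS.genericPoint ⤳ y := hgen.specializes (subset_closure hy)
    rw [hdim _ h1] at h2
    exact (hx y h2).symm
  have h1 := hX.pure_one_dimensional _ hcomp
  have h2 := topologicalKrullDim_zero_of_discreteTopology ({x} : Set X)
  rw [h1] at h2
  exact absurd h2 (by decide)

end Scheme

/-! ### Points and local rings of a closed subscheme of `ℙ³` -/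

section Points

variable {K : Type*} [Field K] {J : HomogeneousIdeal (stdGrading K)}

theorem decompose_stdGrading (p : CoordRing K) (n : ℕ) :
    (DirectSum.decompose (stdGrading K) p n : CoordRing K) = homogeneousComponent n p :=
  decomposition.decompose'_apply p n

theorem decompose_mk (p : CoordRing K) (n : ℕ) :
    (DirectSum.decompose (quotGrading J) (Ideal.Quotient.mk J.toIdeal p) n :
      CoordRing K ⧸ J.toIdeal) = Ideal.Quotient.mk J.toIdeal (homogeneousComponent n p) := by
  have hmem (i : ℕ) : Ideal.Quotient.mk J.toIdeal (homogeneousComponent i p) ∈ quotGrading J i :=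
    mem_quotGrading.2 ⟨_, homogeneousComponent_mem i p, rfl⟩
  conv_lhs => rw [← sum_homogeneousComponent p]
  rw [map_sum, DirectSum.decompose_sum, DFinsupp.finsetSum_apply, AddSubmonoidClass.coe_finsetSum]
  have key (i : ℕ) : (DirectSum.decompose (quotGrading J)
      (Ideal.Quotient.mk J.toIdeal (homogeneousComponent i p)) n : CoordRing K ⧸ J.toIdeal) =
      if i = n then Ideal.Quotient.mk J.toIdeal (homogeneousComponent n p) else 0 := by
    split_ifs with h
    · subst h
      exact DirectSum.decompose_of_mem_same _ (hmem i)
    · exact DirectSum.decompose_of_mem_ne _ (hmem i) h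
  simp only [key]
  rw [Finset.sum_ite_eq']
  split_ifs with h
  · rfl
  · rw [homogeneousComponent_eq_zero n p (by simpa using h), map_zero]

/-- The homogeneous prime ideal of `K[x, y, z, t]` corresponding to a point of
`Proj (K[x, y, z, t] ⧸ J)`. -/
noncomputable def pointIdeal (x : projSubscheme J) : Ideal (CoordRing K) :=
  (show ProjectiveSpectrum (quotGrading J) from x).asHomogeneousIdeal.toIdeal.comap
    (Ideal.Quotient.mk J.toIdeal)

instance (x : projSubscheme J) : (pointIdeal x).IsPrime :=
  Ideal.IsPrime.comap _ (hK := (show ProjectiveSpectrum (quotGrading J) from x).isPrime)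

theorem le_pointIdeal (x : projSubscheme J) : J.toIdeal ≤ pointIdeal x := by
  intro p hp
  rw [pointIdeal, Ideal.mem_comap, Ideal.Quotient.eq_zero_iff_mem.2 hp]
  exact zero_mem _

theorem pointIdeal_isHomogeneous (x : projSubscheme J) :
    (pointIdeal x).IsHomogeneous (stdGrading K) := by
  intro n p hp
  rw [pointIdeal, Ideal.mem_comap] at hp ⊢
  have h := (show ProjectiveSpectrum (quotGrading J) from x).asHomogeneousIdeal.isHomogeneous n hp
  rw [decompose_mk] at h
  rw [decompose_stdGrading]
  exact h

theorem not_irrelevantMaxIdeal_le_pointIdeal (x : projSubscheme J) :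
    ¬ irrelevantMaxIdeal K ≤ pointIdeal x := by
  intro hle
  refine (show ProjectiveSpectrum (quotGrading J) from x).not_irrelevant_le fun q hq => ?_
  obtain ⟨p, rfl⟩ := Ideal.Quotient.mk_surjective q
  have h0 : Ideal.Quotient.mk J.toIdeal (homogeneousComponent 0 p) = 0 := by
    rw [← decompose_mk]
    exact hq
  rw [← sum_homogeneousComponent p, map_sum]
  refine Ideal.sum_mem _ fun n _ => ?_
  rcases Nat.eq_zero_or_pos n with rfl | hn
  · rw [h0]; exact zero_mem _
  · exact hle ((IsHomogeneousOfDegree.of_isHomogeneous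
      (homogeneousComponent_isHomogeneous n p)).mem_irrelevantMaxIdeal (by exact_mod_cast hn))

theorem pointIdeal_lt_irrelevantMaxIdeal (x : projSubscheme J) :
    pointIdeal x < irrelevantMaxIdeal K :=
  lt_of_le_not_ge (le_irrelevantMaxIdeal (pointIdeal_isHomogeneous x) (Ideal.IsPrime.ne_top'))
    (not_irrelevantMaxIdeal_le_pointIdeal x)

theorem specializes_iff_pointIdeal_le {x y : projSubscheme J} :
    x ⤳ y ↔ pointIdeal x ≤ pointIdeal y := by
  rw [specializes_iff_mem_closure, pointIdeal, pointIdeal,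
    Ideal.comap_le_comap_iff_of_surjective _ Ideal.Quotient.mk_surjective]
  exact (ProjectiveSpectrum.le_iff_mem_closure (𝒜 := quotGrading J) x y).symm

theorem pointIdeal_injective : Function.Injective (pointIdeal (J := J)) := fun _ _ h =>
  ((specializes_iff_pointIdeal_le.2 h.le).antisymm (specializes_iff_pointIdeal_le.2 h.ge)).eq

theorem exists_pointIdeal_eq {p : Ideal (CoordRing K)} (hp : p.IsPrime)
    (hhom : p.IsHomogeneous (stdGrading K)) (hJ : J.toIdeal ≤ p)
    (hirr : ¬ irrelevantMaxIdeal K ≤ p) : ∃ x : projSubscheme J, pointIdeal x = p := by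
  have hcomap : (p.map (Ideal.Quotient.mk J.toIdeal)).comap (Ideal.Quotient.mk J.toIdeal) = p := by
    rw [Ideal.comap_map_of_surjective _ Ideal.Quotient.mk_surjective, sup_eq_left,
      ← RingHom.ker_eq_comap_bot, Ideal.mk_ker]
    exact hJ
  have hmem {a : CoordRing K} :
      Ideal.Quotient.mk J.toIdeal a ∈ p.map (Ideal.Quotient.mk J.toIdeal) ↔ a ∈ p := by
    rw [← Ideal.mem_comap, hcomap]
  have hprime : (p.map (Ideal.Quotient.mk J.toIdeal)).IsPrime :=
    Ideal.map_isPrime_of_surjective Ideal.Quotient.mk_surjective (by rwa [Ideal.mk_ker])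
  let I : HomogeneousIdeal (quotGrading J) :=
    { toSubmodule := p.map (Ideal.Quotient.mk J.toIdeal)
      is_homogeneous' := by
        intro n q hq
        obtain ⟨a, rfl⟩ := Ideal.Quotient.mk_surjective q
        rw [decompose_mk]
        exact hmem.2 (homogeneousComponent_mem_of_mem hhom (hmem.1 hq) n) }
  refine ⟨(⟨I, hprime, fun hle => hirr ?_⟩ : ProjectiveSpectrum (quotGrading J)), hcomap⟩
  rw [irrelevantMaxIdeal, Ideal.span_le]
  rintro _ ⟨i, rfl⟩
  refine hmem.1 (hle ?_)
  change (DirectSum.decompose (quotGrading J) (Ideal.Quotient.mk J.toIdeal (X i)) 0 :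
    CoordRing K ⧸ J.toIdeal) = 0
  rw [decompose_mk, homogeneousComponent_of_mem (isHomogeneous_X K i), if_neg one_ne_zero.symm,
    map_zero]

/-- A homogeneous prime ideal strictly between the ideal of `x` and `(x, y, z, t)` shows that `x` is
not a closed point. -/
theorem exists_specializes_of_lt {x : projSubscheme J} {q : Ideal (CoordRing K)} (hq : q.IsPrime)
    (hhom : q.IsHomogeneous (stdGrading K)) (hirr : ¬ irrelevantMaxIdeal K ≤ q)
    (hlt : pointIdeal x < q) : ∃ y, x ⤳ y ∧ x ≠ y := by
  obtain ⟨y, rfl⟩ := exists_pointIdeal_eq (J := J) hq hhom ((le_pointIdeal x).trans hlt.le) hirr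
  exact ⟨y, specializes_iff_pointIdeal_le.2 hlt.le, by rintro rfl; exact hlt.ne rfl⟩

theorem exists_X_notMem_pointIdeal (x : projSubscheme J) : ∃ i, X i ∉ pointIdeal x := by
  by_contra! hcon
  refine not_irrelevantMaxIdeal_le_pointIdeal x ?_
  rw [irrelevantMaxIdeal, Ideal.span_le]
  rintro _ ⟨i, rfl⟩
  exact hcon i

/-- The local ring at a point of `Proj (K[x, y, z, t] ⧸ J)`, as the ring of fractions of degree
zero. -/
abbrev pointLocalRing (x : projSubscheme J) : Type _ :=
  HomogeneousLocalization.AtPrime (quotGrading J)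
    (show ProjectiveSpectrum (quotGrading J) from x).asHomogeneousIdeal.toIdeal

/-- The identification of the stalk with the ring of fractions of degree zero. -/
noncomputable def stalkEquiv (x : projSubscheme J) :
    (projSubscheme J).presheaf.stalk x ≃+* pointLocalRing x :=
  (Proj.stalkIso (quotGrading J) x).commRingCatIsoToRingEquiv

/-- The fraction `a / b` of forms of the same degree. -/
noncomputable def pointFraction (x : projSubscheme J) {n : ℕ} {a b : CoordRing K}
    (ha : a.IsHomogeneous n) (hb : b.IsHomogeneous n) (hbx : b ∉ pointIdeal x) :
    pointLocalRing x :=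
  HomogeneousLocalization.mk
    ⟨n, ⟨Ideal.Quotient.mk J.toIdeal a, mem_quotGrading.2 ⟨a, ha, rfl⟩⟩,
      ⟨Ideal.Quotient.mk J.toIdeal b, mem_quotGrading.2 ⟨b, hb, rfl⟩⟩, hbx⟩

variable {x : projSubscheme J} {n : ℕ} {a b : CoordRing K}
  {ha : a.IsHomogeneous n} {hb : b.IsHomogeneous n} {hbx : b ∉ pointIdeal x}

theorem exists_eq_pointFraction (u : pointLocalRing x) :
    ∃ (n : ℕ) (a b : CoordRing K) (ha : a.IsHomogeneous n) (hb : b.IsHomogeneous n)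
      (hbx : b ∉ pointIdeal x), u = pointFraction x ha hb hbx := by
  obtain ⟨⟨n, ⟨_, a, ha, rfl⟩, ⟨_, b, hb, rfl⟩, hden⟩, rfl⟩ :=
    HomogeneousLocalization.mk_surjective u
  exact ⟨n, a, b, ha, hb, hden, rfl⟩

theorem pointFraction_eq_zero_iff :
    pointFraction x ha hb hbx = 0 ↔ ∃ c ∉ pointIdeal x, c * a ∈ J.toIdeal := by
  rw [HomogeneousLocalization.ext_iff_val, HomogeneousLocalization.val_zero, pointFraction,
    HomogeneousLocalization.val_mk, Localization.mk_eq_mk', IsLocalization.mk'_eq_zero_iff]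
  constructor
  · rintro ⟨⟨c, hc⟩, h⟩
    obtain ⟨c, rfl⟩ := Ideal.Quotient.mk_surjective c
    exact ⟨c, hc, Ideal.Quotient.eq_zero_iff_mem.1 (by simpa using h)⟩
  · rintro ⟨c, hc, h⟩
    exact ⟨⟨Ideal.Quotient.mk J.toIdeal c, hc⟩, by
      simpa using Ideal.Quotient.eq_zero_iff_mem.2 h⟩

theorem pointFraction_mul {m : ℕ} {a' b' : CoordRing K}
    {ha' : a'.IsHomogeneous m} {hb' : b'.IsHomogeneous m} {hbx' : b' ∉ pointIdeal x} :
    pointFraction x ha hb hbx * pointFraction x ha' hb' hbx' =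
      pointFraction x (ha.mul ha') (hb.mul hb')
        (fun h => ((inferInstance : (pointIdeal x).IsPrime).mem_or_mem h).elim hbx hbx') :=
  rfl

theorem pointFraction_mem_maximalIdeal_iff :
    pointFraction x ha hb hbx ∈ IsLocalRing.maximalIdeal (pointLocalRing x) ↔
      a ∈ pointIdeal x := by
  rw [IsLocalRing.mem_maximalIdeal, mem_nonunits_iff,
    ← HomogeneousLocalization.isUnit_iff_isUnit_val, pointFraction, HomogeneousLocalization.val_mk,
    Localization.mk_eq_mk',
    IsLocalization.AtPrime.isUnit_mk'_iff _
      (show ProjectiveSpectrum (quotGrading J) from x).asHomogeneousIdeal.toIdeal]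
  exact not_not

/-- If a form `l` vanishing at `x` is a nonzerodivisor locally at `x`, then the local ring at `x`
has positive depth. -/
theorem exists_nonZeroDivisor_stalk {l : CoordRing K} {d : ℕ} (hl : l.IsHomogeneous d)
    (hlx : l ∈ pointIdeal x)
    (hreg : ∀ a, l * a ∈ J.toIdeal → ∃ c ∉ pointIdeal x, c * a ∈ J.toIdeal) :
    ∃ u ∈ IsLocalRing.maximalIdeal ((projSubscheme J).presheaf.stalk x),
      u ∈ nonZeroDivisors ((projSubscheme J).presheaf.stalk x) := by
  have hp : (pointIdeal x).IsPrime := inferInstance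
  obtain ⟨i, hi⟩ := exists_X_notMem_pointIdeal x
  have hpow : (X i ^ d : CoordRing K).IsHomogeneous d := by
    simpa using (isHomogeneous_X K i).pow d
  have hpx : X i ^ d ∉ pointIdeal x := fun h => hi (hp.mem_of_pow_mem _ h)
  set u := pointFraction x hl hpow hpx with hu
  have hmax : u ∈ IsLocalRing.maximalIdeal (pointLocalRing x) :=
    pointFraction_mem_maximalIdeal_iff.2 hlx
  have hnzd : ∀ v, v * u = 0 → v = 0 := by
    intro v hv
    obtain ⟨n, a, b, ha, hb, hbx, rfl⟩ := exists_eq_pointFraction v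
    rw [hu, pointFraction_mul, pointFraction_eq_zero_iff] at hv
    obtain ⟨c, hc, hcJ⟩ := hv
    obtain ⟨c', hc', hcJ'⟩ := hreg (c * a) (by convert hcJ using 1; ring)
    rw [pointFraction_eq_zero_iff]
    exact ⟨c' * c, fun h => (hp.mem_or_mem h).elim hc' hc, by rwa [mul_assoc]⟩
  refine ⟨(stalkEquiv x).symm u, ?_, ?_⟩
  · rw [IsLocalRing.mem_maximalIdeal, mem_nonunits_iff] at hmax ⊢
    rwa [MulEquiv.isUnit_map]
  · rw [mem_nonZeroDivisors_iff_right]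
    intro v hv
    refine (map_eq_zero_iff _ (stalkEquiv x).injective).1 (hnzd _ ?_)
    have := congrArg (stalkEquiv x) hv
    simpa using this

/-- A form `s` which vanishes in no neighbourhood of `x` but is killed by the ideal of `x` produces
a nonzero element of the local ring killed by the maximal ideal. -/
theorem exists_socle_stalk {s : CoordRing K} {d : ℕ} (hs : s.IsHomogeneous d)
    (hsoc : ∀ a ∈ pointIdeal x, s * a ∈ J.toIdeal)
    (hann : ∀ c, s * c ∈ J.toIdeal → c ∈ pointIdeal x) :
    ∃ s' : (projSubscheme J).presheaf.stalk x, s' ≠ 0 ∧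
      ∀ u ∈ IsLocalRing.maximalIdeal ((projSubscheme J).presheaf.stalk x), u * s' = 0 := by
  have hp : (pointIdeal x).IsPrime := inferInstance
  obtain ⟨i, hi⟩ := exists_X_notMem_pointIdeal x
  have hpow : (X i ^ d : CoordRing K).IsHomogeneous d := by
    simpa using (isHomogeneous_X K i).pow d
  have hpx : X i ^ d ∉ pointIdeal x := fun h => hi (hp.mem_of_pow_mem _ h)
  set s' := pointFraction x hs hpow hpx with hs'
  have hne : s' ≠ 0 := by
    rw [hs', Ne, pointFraction_eq_zero_iff]
    rintro ⟨c, hc, hcJ⟩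
    exact hc (hann c (by rwa [mul_comm]))
  refine ⟨(stalkEquiv x).symm s', fun h => hne ?_, fun u hu => ?_⟩
  · exact (map_eq_zero_iff _ (stalkEquiv x).symm.injective).1 h
  · obtain ⟨n, a, b, ha, hb, hbx, hab⟩ := exists_eq_pointFraction (stalkEquiv x u)
    have hau : a ∈ pointIdeal x := by
      rw [← pointFraction_mem_maximalIdeal_iff (ha := ha) (hb := hb) (hbx := hbx), ← hab]
      rw [IsLocalRing.mem_maximalIdeal, mem_nonunits_iff] at hu ⊢
      rwa [MulEquiv.isUnit_map]
    refine (map_eq_zero_iff _ (stalkEquiv x).injective).1 ?_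
    rw [map_mul, hab, RingEquiv.apply_symm_apply, hs', pointFraction_mul,
      pointFraction_eq_zero_iff]
    refine ⟨1, fun h => hp.ne_top ((Ideal.eq_top_iff_one _).2 h), ?_⟩
    rw [one_mul, mul_comm]
    exact hsoc a hau

end Points

/-! ### The points of the curve -/

section Curve

variable {K : Type*} [Field K] {h F G A B : CoordRing K}

theorem IsHomogeneousOfDegree.exists_isHomogeneous {p : CoordRing K} {d : ℤ}
    (hp : IsHomogeneousOfDegree p d) : ∃ n, p.IsHomogeneous n := by
  rcases hp with rfl | ⟨n, -, hn⟩
  · exact ⟨0, isHomogeneous_zero _ _ _⟩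
  · exact ⟨n, hn⟩

/-- The ideal of a component `Xᵢ = q = 0` of a plane curve `Xᵢ = f = 0` is a homogeneous prime which
is strictly contained in the ideal of a point. -/
theorem isPrime_and_exists_lt_of_mem_factors {i : Fin 4} {f q : CoordRing K} {n : ℕ}
    (hf : f ∈ supported K {i}ᶜ) (hf0 : f ≠ 0) (hfdeg : f.IsHomogeneous n)
    (hq : q ∈ UniqueFactorizationMonoid.factors f) :
    (Ideal.span (X '' {i}) ⊔ Ideal.span {q}).IsPrime ∧
      (Ideal.span (X '' {i}) ⊔ Ideal.span {q}).IsHomogeneous (stdGrading K) ∧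
      ∃ P : Ideal (CoordRing K), P.IsPrime ∧ P.IsHomogeneous (stdGrading K) ∧
        Ideal.span (X '' {i}) ⊔ Ideal.span {q} < P ∧ ¬ irrelevantMaxIdeal K ≤ P := by
  have hqf := UniqueFactorizationMonoid.dvd_of_mem_factors hq
  have hprime := isPrime_span_X_image_sup (killVars_eq_of_dvd hf0 hf hqf)
    (UniqueFactorizationMonoid.prime_of_factor q hq)
  have hX : SetLike.IsHomogeneousElem (stdGrading K) (X i : CoordRing K) :=
    ⟨1, isHomogeneous_X K i⟩
  have hqh : SetLike.IsHomogeneousElem (stdGrading K) q := hfdeg.exists_of_dvd hf0 hqf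
  have heq : Ideal.span (X '' {i}) ⊔ Ideal.span {q} = Ideal.span {X i, q} := by
    rw [Set.image_singleton, ← Ideal.span_insert]
  refine ⟨hprime, ?_, ?_⟩
  · rw [heq]
    refine Ideal.homogeneous_span _ _ ?_
    rintro _ (rfl | rfl)
    · exact hX
    · exact hqh
  · rw [heq] at hprime ⊢
    exact exists_lt_of_span_pair hprime hX hqh

theorem eq_or_eq_of_specializes (D : CurveDatum (X 0) (X 1) h F G A B)
    (hJ : (curveIdeal (X 0) (X 1) h F G A B).IsHomogeneous (stdGrading K))
    (x y z : projSubscheme ⟨curveIdeal (X 0) (X 1) h F G A B, hJ⟩) (hxy : x ⤳ y) (hyz : y ⤳ z) :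
    x = y ∨ y = z := by
  by_contra! hcon
  rw [specializes_iff_pointIdeal_le] at hxy hyz
  exact not_chain_of_two_le_height inferInstance inferInstance inferInstance
    (two_le_height_of_curveIdeal_le D inferInstance (le_pointIdeal x))
    (lt_of_le_of_ne hxy fun e => hcon.1 (pointIdeal_injective e))
    (lt_of_le_of_ne hyz fun e => hcon.2 (pointIdeal_injective e))
    (pointIdeal_lt_irrelevantMaxIdeal z)

/-- The generic point of a component of `x = yB + hG = 0` is a nonclosed point of the curve. -/
theorem exists_specializes_ne {n : ℕ}
    (hg : X 1 * B + h * G ∈ supported K ({0}ᶜ : Set (Fin 4))) (hg0 : X 1 * B + h * G ≠ 0)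
    (hgdeg : (X 1 * B + h * G).IsHomogeneous n) (hG : G ∈ irrelevantMaxIdeal K)
    (hJ : (curveIdeal (X 0) (X 1) h F G A B).IsHomogeneous (stdGrading K)) :
    ∃ x y : projSubscheme ⟨curveIdeal (X 0) (X 1) h F G A B, hJ⟩, x ⤳ y ∧ x ≠ y := by
  have hgm : X 1 * B + h * G ∈ irrelevantMaxIdeal K :=
    add_mem (Ideal.mul_mem_right _ _ (Ideal.subset_span ⟨1, rfl⟩)) (Ideal.mul_mem_left _ _ hG)
  have hgu : ¬ IsUnit (X 1 * B + h * G) := fun hu =>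
    irrelevantMaxIdeal_isPrime.ne_top (Ideal.eq_top_of_isUnit_mem _ hgm hu)
  obtain ⟨q, hq⟩ := UniqueFactorizationMonoid.exists_mem_factors hg0 hgu
  obtain ⟨hprime, hhom, P, hP1, hP2, hlt, hP⟩ :=
    isPrime_and_exists_lt_of_mem_factors hg hg0 hgdeg hq
  have hle : curveIdeal (X 0) (X 1) h F G A B ≤ Ideal.span (X '' {0}) ⊔ Ideal.span {q} := by
    refine (curveIdeal_le_span_x _ _ _ _ _ _ _).trans ?_
    rw [Ideal.span_insert, Set.image_singleton]
    exact sup_le_sup_left (Ideal.span_singleton_le_span_singleton.2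
      (UniqueFactorizationMonoid.dvd_of_mem_factors hq)) _
  obtain ⟨x, hx⟩ := exists_pointIdeal_eq (J := ⟨curveIdeal (X 0) (X 1) h F G A B, hJ⟩) hprime hhom
    hle fun hm => hP (hm.trans hlt.le)
  obtain ⟨y, hy⟩ := exists_specializes_of_lt (x := x) hP1 hP2 hP (hx ▸ hlt)
  exact ⟨x, y, hy⟩

theorem topologicalKrullDim_projSubscheme (D : CurveDatum (X 0) (X 1) h F G A B) {n : ℕ}
    (hg : X 1 * B + h * G ∈ supported K ({0}ᶜ : Set (Fin 4))) (hg0 : X 1 * B + h * G ≠ 0)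
    (hgdeg : (X 1 * B + h * G).IsHomogeneous n) (hG : G ∈ irrelevantMaxIdeal K)
    (hJ : (curveIdeal (X 0) (X 1) h F G A B).IsHomogeneous (stdGrading K)) :
    topologicalKrullDim (projSubscheme ⟨curveIdeal (X 0) (X 1) h F G A B, hJ⟩) = 1 := by
  obtain ⟨x, y, hxy, hne⟩ := exists_specializes_ne (F := F) (A := A) hg hg0 hgdeg hG hJ
  exact le_antisymm (topologicalKrullDim_le_one_of_specializes (eq_or_eq_of_specializes D hJ))
    (one_le_topologicalKrullDim_of_specializes hxy hne)

/-- If `F` and `G` are relatively prime, the local ring at every closed point has positive depth: a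
form vanishing at the point, but on no component of the two plane curves, is a nonzerodivisor. -/
theorem isLocallyCMCurve_of_isRelPrime [Infinite K] (D : CurveDatum (X 0) (X 1) h F G A B)
    {m n : ℕ} (hF : F ∈ supported K ({2, 3} : Set (Fin 4)))
    (hG : G ∈ supported K ({2, 3} : Set (Fin 4))) (hF0 : F ≠ 0) (hrel : IsRelPrime F G)
    (hf : X 0 * A + h * F ∈ supported K ({1}ᶜ : Set (Fin 4))) (hf0 : X 0 * A + h * F ≠ 0)
    (hfdeg : (X 0 * A + h * F).IsHomogeneous m)
    (hg : X 1 * B + h * G ∈ supported K ({0}ᶜ : Set (Fin 4))) (hg0 : X 1 * B + h * G ≠ 0)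
    (hgdeg : (X 1 * B + h * G).IsHomogeneous n) (hGm : G ∈ irrelevantMaxIdeal K)
    (hJ : (curveIdeal (X 0) (X 1) h F G A B).IsHomogeneous (stdGrading K)) :
    IsLocallyCMCurve (projSubscheme ⟨curveIdeal (X 0) (X 1) h F G A B, hJ⟩) := by
  classical
  obtain ⟨x₀, -⟩ := exists_specializes_ne (F := F) (A := A) hg hg0 hgdeg hGm hJ
  have : Nonempty (projSubscheme ⟨curveIdeal (X 0) (X 1) h F G A B, hJ⟩) := ⟨x₀⟩
  refine isLocallyCMCurve_of_exists_nonZeroDivisor (eq_or_eq_of_specializes D hJ) fun x hx => ?_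
  let S : Finset (Ideal (CoordRing K)) :=
    (UniqueFactorizationMonoid.factors (X 0 * A + h * F)).toFinset.image
        (fun q => Ideal.span (X '' {1}) ⊔ Ideal.span {q}) ∪
      (UniqueFactorizationMonoid.factors (X 1 * B + h * G)).toFinset.image
        (fun q => Ideal.span (X '' {0}) ⊔ Ideal.span {q})
  have hS : ∀ Q ∈ S, Q.IsPrime ∧ Q.IsHomogeneous (stdGrading K) ∧
      ∃ P : Ideal (CoordRing K), P.IsPrime ∧ P.IsHomogeneous (stdGrading K) ∧
        Q < P ∧ ¬ irrelevantMaxIdeal K ≤ P := by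
    intro Q hQ
    rcases Finset.mem_union.1 hQ with hQ | hQ
    · obtain ⟨q, hq, rfl⟩ := Finset.mem_image.1 hQ
      exact isPrime_and_exists_lt_of_mem_factors hf hf0 hfdeg (Multiset.mem_toFinset.1 hq)
    · obtain ⟨q, hq, rfl⟩ := Finset.mem_image.1 hQ
      exact isPrime_and_exists_lt_of_mem_factors hg hg0 hgdeg (Multiset.mem_toFinset.1 hq)
  obtain ⟨d, l, hlx, hldeg, hlS⟩ := exists_form_avoiding (pointIdeal_isHomogeneous x) S
    (fun Q hQ => (hS Q hQ).1)
    (fun Q hQ hm => by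
      obtain ⟨-, -, P, -, -, hlt, hP⟩ := hS Q hQ
      exact hP (hm.trans hlt.le))
    (fun Q hQ hle => by
      obtain ⟨-, -, P, hP1, hP2, hlt, hP⟩ := hS Q hQ
      obtain ⟨y, hxy, hne⟩ := exists_specializes_of_lt hP1 hP2 hP (hle.trans_lt hlt)
      exact hne (hx y hxy))
  have hlf (a : CoordRing K) (ha : l * a ∈ Ideal.span {X 1, X 0 * A + h * F}) :
      a ∈ Ideal.span {X 1, X 0 * A + h * F} :=
    mem_of_mul_mem_of_avoiding hf hf0 (fun q hq => hlS _ (Finset.mem_union_left _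
      (Finset.mem_image_of_mem _ (Multiset.mem_toFinset.2 hq)))) ha
  have hlg (a : CoordRing K) (ha : l * a ∈ Ideal.span {X 0, X 1 * B + h * G}) :
      a ∈ Ideal.span {X 0, X 1 * B + h * G} :=
    mem_of_mul_mem_of_avoiding hg hg0 (fun q hq => hlS _ (Finset.mem_union_right _
      (Finset.mem_image_of_mem _ (Multiset.mem_toFinset.2 hq)))) ha
  refine exists_nonZeroDivisor_stalk hldeg hlx fun a ha => ?_
  by_contra! hcon
  have h1 (w : CoordRing K) (hw : w = F ∨ w = X 1) : w ∈ pointIdeal x := by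
    by_contra hwx
    exact hcon w hwx (D.exists_mul_mem_of_F_or_y hlf hlg hw ha)
  have h2 (w : CoordRing K) (hw : w = G ∨ w = X 0) : w ∈ pointIdeal x := by
    by_contra hwx
    refine hcon w hwx ?_
    have := D.swap.exists_mul_mem_of_F_or_y hlg hlf hw (a := a) (by rwa [curveIdeal_swap])
    rwa [curveIdeal_swap] at this
  exact not_irrelevantMaxIdeal_le_pointIdeal x (irrelevantMaxIdeal_le_of_isRelPrime hF hG hF0 hrel
    inferInstance (pointIdeal_lt_irrelevantMaxIdeal x).le (h2 _ (Or.inr rfl)) (h1 _ (Or.inr rfl))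
    (h1 _ (Or.inl rfl)) (h2 _ (Or.inl rfl)))

/-- A common prime factor `l` of `F` and `G` gives the closed point `x = y = l = 0`, at which the
local ring has depth zero. -/
theorem isRelPrime_of_isLocallyCMCurve {dF dG : ℕ} {dh : ℤ}
    (D : CurveDatum (X 0) (X 1) h F G A B)
    (hF : F ∈ supported K ({2, 3} : Set (Fin 4))) (hF0 : F ≠ 0) (hG0 : G ≠ 0)
    (hFdeg : F.IsHomogeneous dF) (hGdeg : G.IsHomogeneous dG)
    (hhdeg : IsHomogeneousOfDegree h dh) (hAdeg : IsHomogeneousOfDegree A (dh + dF - 1))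
    (hBdeg : IsHomogeneousOfDegree B (dh + dG - 1))
    (hJ : (curveIdeal (X 0) (X 1) h F G A B).IsHomogeneous (stdGrading K))
    (hCM : IsLocallyCMCurve (projSubscheme ⟨curveIdeal (X 0) (X 1) h F G A B, hJ⟩)) :
    IsRelPrime F G := by
  intro d hdF hdG
  by_contra hd
  obtain ⟨l, hl, hld⟩ := WfDvdMonoid.exists_irreducible_factor hd (ne_zero_of_dvd_ne_zero hF0 hdF)
  have hkill : killVars K {0, 1} l = l := killVars_eq_of_dvd hF0
    (supported_mono (by intro i; fin_cases i <;> simp) hF) (hld.trans hdF)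
  obtain ⟨e, hle⟩ := hFdeg.exists_of_dvd hF0 (hld.trans hdF)
  obtain ⟨F₁, rfl⟩ := hld.trans hdF
  obtain ⟨G₁, rfl⟩ := hld.trans hdG
  obtain ⟨a, hF₁⟩ := hFdeg.exists_of_dvd hF0 (dvd_mul_left F₁ l)
  obtain ⟨b, hG₁⟩ := hGdeg.exists_of_dvd hG0 (dvd_mul_left G₁ l)
  obtain rfl := hFdeg.inj_right (hle.mul hF₁) hF0
  obtain rfl := hGdeg.inj_right (hle.mul hG₁) hG0
  have hprime := isPrime_span_X_image_sup hkill hl.prime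
  have hht := three_le_height hkill hl.prime
  rw [Set.image_pair] at hprime hht
  rw [← Ideal.span_union, show ({X 0, X 1} ∪ {l} : Set (CoordRing K)) = {X 0, X 1, l} by
    ext; simp; tauto] at hprime hht
  have hhom : (Ideal.span {X 0, X 1, l}).IsHomogeneous (stdGrading K) := by
    refine Ideal.homogeneous_span _ _ ?_
    rintro _ (rfl | rfl | rfl)
    · exact ⟨1, isHomogeneous_X K 0⟩
    · exact ⟨1, isHomogeneous_X K 1⟩
    · exact ⟨e, hle⟩
  have hJle : curveIdeal (X 0) (X 1) h (l * F₁) (l * G₁) A B ≤ Ideal.span {X 0, X 1, l} := by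
    refine (curveIdeal_le_span_x _ _ _ _ _ _ _).trans ?_
    rw [Ideal.span_le]
    rintro _ (rfl | rfl)
    · exact Ideal.subset_span (by simp)
    · refine add_mem (Ideal.mul_mem_right _ _ (Ideal.subset_span (by simp))) ?_
      rw [show h * (l * G₁) = h * G₁ * l by ring]
      exact Ideal.mul_mem_left _ _ (Ideal.subset_span (by simp))
  -- a prime `l` cannot divide both `z` and `t`
  have hirr : ¬ irrelevantMaxIdeal K ≤ Ideal.span {X 0, X 1, l} := by
    intro hm
    have aux (i : Fin 4) (hi : i ∉ ({0, 1} : Set (Fin 4))) : l ∣ X i := by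
      have h1 : X i ∈ Ideal.span {X 0, X 1, l} := hm (Ideal.subset_span ⟨i, rfl⟩)
      rw [show ({X 0, X 1, l} : Set (CoordRing K)) = X '' {0, 1} ∪ {l} by
        rw [Set.image_pair]; ext; simp; tauto, Ideal.span_union,
        mem_span_X_image_sup_iff hkill, killVars_X_of_notMem hi] at h1
      exact h1
    have h2 := hl.dvd_symm (X_prime (R := K) (i := (2 : Fin 4))).irreducible (aux 2 (by simp))
    have h3 := h2.trans (aux 3 (by simp))
    rw [X_dvd_X] at h3
    simp at h3
  obtain ⟨x, hx⟩ := exists_pointIdeal_eq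
    (J := ⟨curveIdeal (X 0) (X 1) h (l * F₁) (l * G₁) A B, hJ⟩) hprime hhom hJle hirr
  have hclosed (y) (hxy : x ⤳ y) : x = y := by
    by_contra hne
    have h1 := height_add_one_le_of_lt (p := pointIdeal x) inferInstance inferInstance
      (lt_of_le_of_ne (specializes_iff_pointIdeal_le.1 hxy)
        fun e => hne (pointIdeal_injective e))
    have h2 := height_add_one_le_of_lt inferInstance irrelevantMaxIdeal_isPrime
      (pointIdeal_lt_irrelevantMaxIdeal y)
    rw [height_irrelevantMaxIdeal] at h2
    rw [hx] at h1
    have h3 : (3 + 1 + 1 : ℕ∞) ≤ 4 :=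
      (add_le_add_left ((add_le_add_left hht 1).trans h1) 1).trans h2
    exact absurd h3 (by decide)
  have hs : ∃ n, (X 0 * A * G₁ + X 1 * B * F₁ + h * (l * F₁) * G₁).IsHomogeneous n := by
    have d0 := IsHomogeneousOfDegree.X (K := K) 0
    have d1 := IsHomogeneousOfDegree.X (K := K) 1
    have dF₁ := IsHomogeneousOfDegree.of_isHomogeneous hF₁
    have dG₁ := IsHomogeneousOfDegree.of_isHomogeneous hG₁
    have dF := IsHomogeneousOfDegree.of_isHomogeneous hFdeg
    refine IsHomogeneousOfDegree.exists_isHomogeneous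
      ((((d0.mul hAdeg).mul dG₁).add (((d1.mul hBdeg).mul dF₁).congr ?_)).add
        (((hhdeg.mul dF).mul dG₁).congr ?_))
    · push_cast; ring
    · push_cast; ring
  obtain ⟨n, hn⟩ := hs
  obtain ⟨s, hs0, hsoc⟩ := exists_socle_stalk (x := x) hn
    (fun p hp => socle_mul_mem _ _ _ _ _ _ _ _ (hx ▸ hp))
    (fun p hp => hx ▸ mem_of_socle_mul_mem D hp)
  exact hCM.not_socle hclosed hs0 hsoc

end Curve

theorem mainTheorem6 {K : Type*} [Field K] [IsAlgClosed K]
    (h F G A B : CoordRing K) (dh : ℤ) (dF dG : ℕ)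
    (hh : h ∈ supported K ({2, 3} : Set (Fin 4)))
    (hF : F ∈ supported K ({2, 3} : Set (Fin 4)))
    (hG : G ∈ supported K ({2, 3} : Set (Fin 4)))
    (hA : A ∈ supported K ({0, 2, 3} : Set (Fin 4)))
    (hB : B ∈ supported K ({1, 2, 3} : Set (Fin 4)))
    (hF' : F ∉ Set.range (C : K → CoordRing K))
    (hG' : G ∉ Set.range (C : K → CoordRing K))
    (hAB : h = 0 → A * B ≠ 0)
    (hFdeg : F.IsHomogeneous dF)
    (hGdeg : G.IsHomogeneous dG)
    (hhdeg : IsHomogeneousOfDegree h dh)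
    (hAdeg : IsHomogeneousOfDegree A (dh + dF - 1))
    (hBdeg : IsHomogeneousOfDegree B (dh + dG - 1)) :
    let x : CoordRing K := X 0
    let y : CoordRing K := X 1
    let J : Ideal (CoordRing K) :=
      Ideal.span {x * y, x ^ 2 * A + x * h * F, y ^ 2 * B + y * h * G,
        x * A * G + y * B * F + h * F * G}
    ∃ hJ : J.IsHomogeneous (stdGrading K),
      topologicalKrullDim (projSubscheme ⟨J, hJ⟩) = 1 ∧
      HasDegree ⟨J, hJ⟩ 1 (2 * dh + dF + dG) ∧
      IsMinimalGradedFreeResolution J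
        ![2, dF + dh + 1, dG + dh + 1, dF + dG + dh]
        ![dF + dh + 2, dG + dh + 2, dF + dG + dh + 1, dF + dG + dh + 1]
        ![dF + dG + dh + 2]
        !![x * y, x ^ 2 * A + x * h * F, y ^ 2 * B + y * h * G,
            x * A * G + y * B * F + h * F * G]
        !![x * A + h * F, y * B + h * G, A * G, B * F;
            -y, 0, 0, G;
            0, -x, F, 0;
            0, 0, -y, -x]
        !![G; -F; -x; y] ∧
      (IsLocallyCMCurve (projSubscheme ⟨J, hJ⟩) ↔
        RingTheory.Sequence.IsRegular (CoordRing K) [x, y, F, G]) := by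
  intro x y J
  have hF0 := ne_zero_of_notMem_range_C hF'
  have hG0 := ne_zero_of_notMem_range_C hG'
  have hdF := pos_of_notMem_range_C hF' hFdeg
  have hdG := pos_of_notMem_range_C hG' hGdeg
  have D := curveDatum hh hF hG hA hB hF0 hG0 hAB
  have hJ := curveIdeal_isHomogeneous hFdeg hGdeg hhdeg hAdeg hBdeg
  have hres := curveIdeal_isMinimalGradedFreeResolution D hdF hdG hFdeg hGdeg hhdeg hAdeg hBdeg
  have hf := f_mem_supported hh hF hA
  have hg := g_mem_supported hh hG hB
  have hf0 : X 0 * A + h * F ≠ 0 :=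
    X_mul_add_ne_zero (by simp) hh hF hF0 fun h0 => left_ne_zero_of_mul (hAB h0)
  have hg0 : X 1 * B + h * G ≠ 0 :=
    X_mul_add_ne_zero (by simp) hh hG hG0 fun h0 => right_ne_zero_of_mul (hAB h0)
  have cF := IsHomogeneousOfDegree.of_isHomogeneous hFdeg
  have cG := IsHomogeneousOfDegree.of_isHomogeneous hGdeg
  obtain ⟨m, hm⟩ := (((IsHomogeneousOfDegree.X 0).mul hAdeg).add
    ((hhdeg.mul cF).congr (by ring))).exists_isHomogeneous
  obtain ⟨n, hn⟩ := (((IsHomogeneousOfDegree.X 1).mul hBdeg).add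
    ((hhdeg.mul cG).congr (by ring))).exists_isHomogeneous
  have hGm := cG.mem_irrelevantMaxIdeal (by exact_mod_cast hdG)
  have : Infinite K := IsAlgClosed.instInfinite
  refine ⟨hJ, topologicalKrullDim_projSubscheme D hg hg0 hn hGm hJ,
    hasDegree_of_isMinimalGradedFreeResolution (J := ⟨_, hJ⟩) hres
      (degree_pos hAB hdF hdG hhdeg hAdeg hBdeg), hres, ?_⟩
  rw [isRegular_X_X_iff_isRelPrime hF hG hF0 hFdeg hGdeg hdF hdG]
  exact ⟨isRelPrime_of_isLocallyCMCurve D hF hF0 hG0 hFdeg hGdeg hhdeg hAdeg hBdeg hJ,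
    fun hrel => isLocallyCMCurve_of_isRelPrime D hF hG hF0 hrel hf hf0 hm hg hg0 hn hGm hJ⟩
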